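/- Let $\Omega_1,\Omega_2\subset\mathbb R^2$ be compact convex obstacles whose boundaries are smooth closed curves with everywhere positive curvature, with counterclockwise arc length parametrizations $\gamma_j$ and exterior unit normal $\nu$. Let $|\alpha|=1$ and assume the no-occlusion condition: some line with direction $\alpha$ passes between $\Omega_1$ and $\Omega_2$ without touching them, i.e. the obstacles lie strictly on opposite sides of it. Put $\partial\Omega=\partial\Omega_1\cup\partial\Omega_2$. The Kirchhoff operator acts on pairs (phase, amplitude). Let $\{j,j'\}=\{1,2\}$ and let $\phi_{j'}:\partial\Omega_{j'}\to\mathbb R$ be smooth such that for each $x\in\partial\Omega_j$ the function $y\mapsto\phi_{j'}(y)+|x-y|$ on $\partial\Omega_{j'}$ has exactly one stationary point $y=y(x)$ with $[x,y]\cap\partial\Omega_{j'}=\{y\}$, and such that its second derivative $D(x)$ in arc length at $y(x)$ is positive (we then call $\phi_{j'}$ admissible). Set $\phi_j(x)=\phi_{j'}(y(x))+|x-y(x)|$ and, for an amplitude $A_{j'}:\partial\Omega_{j'}\to\mathbb C$, $$A_j(x)=A_{j'}(y(x))\,\frac{1}{\sqrt{|x-y(x)|}}\,\frac{x-y(x)}{|x-y(x)|}\cdot\nu(x)\;D(x)^{-1/2}$$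 if $[x,y(x)]\cap\partial\Omega_j=\{x\}$, and $A_j(x)=0$ otherwise. Put $\mathcal K_{jj'}(\phi_{j'},A_{j'})=(\phi_j,A_j)$, abbreviated $\mathcal K_{jj'}(e^{ik\phi_{j'}}A_{j'})=e^{ik\phi_j}A_j$, and $\mathcal K=\begin{bmatrix}0&\mathcal K_{12}\\ \mathcal K_{21}&0\end{bmatrix}$. For $k>0$ and $h\in C(\partial\Omega)$, the iterates $\mathcal K^\ell h$ are formed by writing $h=e^{ik\,\alpha\cdot x}h_0$, i.e. by starting from the phase $\alpha\cdot x$ and the amplitude $h_0$ on both boundary curves, and carrying phase and amplitude along at each step. Theorem. All phases that arise in this way are admissible, so that $\mathcal K^\ell h$ is defined for all $\ell\ge0$; and for all $k>0$ and $\ell\ge 0$, $h\mapsto\mathcal K^\ell h$ is a bounded linear operator on $C(\partial\Omega)$ (with the supremum norm). There are constants $C>0$ and $\delta\in(0,1)$, depending only on $\Omega_1,\Omega_2$ and $\alpha$, such that for all $k>0$, all $h\in C(\partial\Omega)$ and all $\ell\ge0$ $$\|\mathcal K^\ell h\|_\infty\le C\,\delta^\ell\,\|h\|_\infty .$$ In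 particular $\sum_{\ell=0}^\infty\|\mathcal K^\ell h\|_\infty$ converges for all $k>0$. Moreover, for every $k>0$ the limit $r(\mathcal K)=\lim_{\ell\to\infty}\|\mathcal K^\ell\|_\infty^{1/\ell}$ (the spectral radius of $\mathcal K$ on $C(\partial\Omega)$) exists and satisfies $r(\mathcal K)\le\delta<1$. -/

import Mathlib

open Filter Topology Set
open scoped ContDiff

noncomputable section

namespace Kirchhoff

/-- The Euclidean plane. -/
abbrev Plane : Type := EuclideanSpace ℝ (Fin 2)

/-- A smooth, compact, strictly convex planar obstacle, together with the counterclockwise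
arc length parametrization `γ` of its boundary, of period `L`.  Strict convexity is meant in the
sense of differential geometry: the signed curvature `det (γ', γ'')` is positive everywhere
(positivity of this determinant is also what makes `γ` counterclockwise). -/
structure Obstacle where
  body : Set Plane
  isCompact_body : IsCompact body
  convex_body : Convex ℝ body
  γ : ℝ → Plane
  L : ℝ
  L_pos : 0 < L
  contDiff_γ : ContDiff ℝ ∞ γ
  periodic_γ : Function.Periodic γ L
  injOn_γ : InjOn γ (Ico 0 L)
  range_γ : range γ = frontier body
  norm_deriv_γ : ∀ t, ‖deriv γ t‖ = 1
  curvature_pos : ∀ t, 0 < deriv γ t 0 * iteratedDeriv 2 γ t 1 - deriv γ t 1 * iteratedDeriv 2 γ t 0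

namespace Obstacle

variable (Ω : Obstacle)

/-- The boundary curve of the obstacle, as a type. -/
abbrev Boundary : Type := frontier Ω.body

/-- The boundary point with arc length parameter `t`. -/
def pt (t : ℝ) : Ω.Boundary := ⟨Ω.γ t, Ω.range_γ ▸ mem_range_self t⟩

theorem exists_param (y : Ω.Boundary) : ∃ t ∈ Ico 0 Ω.L, Ω.pt t = y := by
  have hy : (y : Plane) ∈ range Ω.γ := by rw [Ω.range_γ]; exact y.2
  obtain ⟨s, hs⟩ := hy
  obtain ⟨t, ht, hst⟩ := Ω.periodic_γ.exists_mem_Ico₀ Ω.L_pos s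
  exact ⟨t, ht, Subtype.ext (hst.symm.trans hs)⟩

/-- The arc length parameter in `[0, L)` of a boundary point; it is unique. -/
def param (y : Ω.Boundary) : ℝ := (Ω.exists_param y).choose

/-- The exterior unit normal at a boundary point: the unit tangent of the counterclockwise
parametrization, rotated by a right angle clockwise. -/
def normal (y : Ω.Boundary) : Plane :=
  !₂[deriv Ω.γ (Ω.param y) 1, -deriv Ω.γ (Ω.param y) 0]

instance : Nonempty Ω.Boundary := ⟨Ω.pt 0⟩

instance : CompactSpace Ω.Boundary :=
  isCompact_iff_compactSpace.mp
    (Ω.isCompact_body.of_isClosed_subset isClosed_frontier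
      Ω.isCompact_body.isClosed.frontier_subset)

end Obstacle

section Transform

/-! In this section `Ω` is the obstacle on which a wave is given and `Λ` is the obstacle
that it is transmitted to. -/

variable (Ω Λ : Obstacle)

/-- The combined phase `φ(y) + |x - y|` as a function of the arc length parameter of `y ∈ ∂Ω`. -/
def combinedPhase (φ : Ω.Boundary → ℝ) (x : Plane) (t : ℝ) : ℝ :=
  φ (Ω.pt t) + ‖x - Ω.γ t‖

/-- `y ∈ ∂Ω` is a stationary point of the combined phase `φ(y) + |x - y|`, and the segment `[x, y]`
meets `∂Ω` only in `y`. -/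
def IsTarget (φ : Ω.Boundary → ℝ) (x : Plane) (y : Ω.Boundary) : Prop :=
  deriv (combinedPhase Ω φ x) (Ω.param y) = 0 ∧
    segment ℝ x (y : Plane) ∩ frontier Ω.body = {(y : Plane)}

/-- The second derivative of the combined phase in the arc length parameter, at the point `y`. -/
def secondDeriv (φ : Ω.Boundary → ℝ) (x : Plane) (y : Ω.Boundary) : ℝ :=
  iteratedDeriv 2 (combinedPhase Ω φ x) (Ω.param y)

/-- The requirements on a phase `φ` on `∂Ω` under which the Kirchhoff operator from `∂Ω` to `∂Λ`
is defined: `φ` is smooth, and for every `x ∈ ∂Λ` there is exactly one target point, at which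
the second derivative of the combined phase is positive. -/
def Admissible (φ : Ω.Boundary → ℝ) : Prop :=
  ContDiff ℝ ∞ (fun t => φ (Ω.pt t)) ∧
    ∀ x : Λ.Boundary, (∃! y, IsTarget Ω φ x y) ∧ ∀ y, IsTarget Ω φ x y → 0 < secondDeriv Ω φ x y

/-- The target point of `x`; it is the unique one when the phase is admissible. -/
def target (φ : Ω.Boundary → ℝ) (x : Plane) : Ω.Boundary :=
  Classical.epsilon (IsTarget Ω φ x)

/-- `F(x, y) = |x - y|^{-1/2} ((x - y) / |x - y|) · ν(x)` for `x ∈ ∂Λ`. -/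
def kernelF (x : Λ.Boundary) (y : Plane) : ℝ :=
  1 / Real.sqrt ‖(x : Plane) - y‖ * (inner ℝ ((x : Plane) - y) (Λ.normal x) / ‖(x : Plane) - y‖)

/-- The transformed phase on `∂Λ`. -/
def transPhase (φ : Ω.Boundary → ℝ) (x : Λ.Boundary) : ℝ :=
  φ (target Ω φ x) + ‖(x : Plane) - (target Ω φ x : Plane)‖

open Classical in
/-- The transformed amplitude on `∂Λ`; it vanishes unless the segment from `x` to its target point
meets `∂Λ` only in `x`. -/
def transAmp (φ : Ω.Boundary → ℝ) (A : Ω.Boundary → ℂ) (x : Λ.Boundary) : ℂ :=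
  if segment ℝ (x : Plane) (target Ω φ x : Plane) ∩ frontier Λ.body = {(x : Plane)} then
    A (target Ω φ x) *
      ((kernelF Λ x (target Ω φ x) *
        (secondDeriv Ω φ x (target Ω φ x)) ^ (-(1 / 2) : ℝ) : ℝ) : ℂ)
  else 0

end Transform

section Iteration

variable (Ω : Fin 2 → Obstacle)

/-- The boundary of the union of two disjoint obstacles: the disjoint union of their boundaries. -/
abbrev TotalBoundary : Type := (j : Fin 2) × (Ω j).Boundary

/-- A phase and an amplitude on each of the two boundary curves. -/
structure Wave where
  phase : ∀ j, (Ω j).Boundary → ℝ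
  amp : ∀ j, (Ω j).Boundary → ℂ

/-- The Kirchhoff operator, a two by two matrix with zero diagonal: the new wave on each obstacle
is the transform of the old wave on the other one (whose index is `1 - j`). -/
def kirchhoff (w : Wave Ω) : Wave Ω where
  phase j := transPhase (Ω (1 - j)) (Ω j) (w.phase (1 - j))
  amp j := transAmp (Ω (1 - j)) (Ω j) (w.phase (1 - j)) (w.amp (1 - j))

/-- The function `e^{ikφ} A` that a wave stands for at wavenumber `k`. -/
def Wave.toFun {Ω : Fin 2 → Obstacle} (w : Wave Ω) (k : ℝ) (x : TotalBoundary Ω) : ℂ :=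
  Complex.exp (Complex.I * k * w.phase x.1 x.2) * w.amp x.1 x.2

/-- The function `h`, written as `e^{ik α·x} h₀`: phase `α · x`, amplitude `h₀ = e^{-ik α·x} h`. -/
def planeWave (α : Plane) (k : ℝ) (h : TotalBoundary Ω → ℂ) : Wave Ω where
  phase _ x := inner ℝ α (x : Plane)
  amp j x := Complex.exp (-(Complex.I * k * (inner ℝ α (x : Plane) : ℝ))) * h ⟨j, x⟩

/-- The `ℓ`-th iterate of the Kirchhoff operator on `h = e^{ik α·x} h₀`, as phase and amplitude. -/
def kirchhoffWave (α : Plane) (k : ℝ) (ℓ : ℕ) (h : TotalBoundary Ω → ℂ) : Wave Ω :=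
  (kirchhoff Ω)^[ℓ] (planeWave Ω α k h)

/-- The function `𝒦^ℓ h` on the boundary. -/
def kirchhoffPow (α : Plane) (k : ℝ) (ℓ : ℕ) (h : TotalBoundary Ω → ℂ) : TotalBoundary Ω → ℂ :=
  (kirchhoffWave Ω α k ℓ h).toFun k

/-- The no-occlusion condition: some line with direction `α` passes between the two obstacles
without touching them, that is, they lie strictly on opposite sides of it. -/
def NoOcclusion (α : Plane) : Prop :=
  ∃ n : Plane, n ≠ 0 ∧ inner ℝ α n = 0 ∧ ∃ c : ℝ,
    (∀ x ∈ (Ω 0).body, inner ℝ x n < c) ∧ ∀ x ∈ (Ω 1).body, c < inner ℝ x n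

end Iteration

end Kirchhoff

end

open Filter Topology Set
open scoped ContDiff

noncomputable section

namespace Kirchhoff

/-! ### Plane geometry -/

/-! This is geometric optics for billiard rays that bounce between two strictly convex obstacles.
The phases of all iterates share one invariant, `Ray`: the phase has a unit subgradient field `e`
(the incoming rays) that never points towards the other obstacle, and its second derivative is that
of a wave front of curvature `κ ≥ 0`. At a stationary point of the combined phase the incoming ray
and the ray to `x` have the same tangential component, so they are equal or mirror images. The
separating line excludes equality and bounds the cosine of reflection below by `c / 2`
(`Ray.isTarget_iff`). The subgradient inequality and strict convexity then make the stationary point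
a unique minimum (`Ray.add_le_of_isTarget`), and `Ray.next` reproduces the invariant, with the
mirror equation `κ' = (κ + b) / (1 + ρ (κ + b))`, `b = 2K / cos`, for the front curvature.

The amplitude factor of one step is the cosine of incidence at `x`, divided by the cosine at the
target and by the square root of the widening `1 + ρ (κ + b)` (`Ray.abs_ampFactor`). The cosines
telescope (`Config.norm_amp_eq`), so the size of the `ℓ`-th iterate is governed by the accumulated
width `wid`. With least distance `d` and least curvature `K`, every step widens the front by at
least `1 + 2dK`, which gives decay with `δ = (1 + 2dK)^(-1/2)`.

For the limit of the roots, the widths must have one exponential rate, uniformly over all rays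
(`Config.exists_growth_rate`). The phase is the path length up to its initial value, and it is `ℓ d
+ O(1)` because it is a minimum over paths (`Config.exists_ph_bound`). So the total excess of the
distances over `d` along any ray is bounded: up to a bounded total error the ray stays near the
unique closest pair of points. There `(wid, wid * κ)` evolves almost by a fixed alternating pair of
positive matrices, and comparison with a positive eigenvector yields the rate. The operator norms
are comparable to the inverse square root of the widths, so their roots converge. -/

theorem inner_plane (a b : Plane) : inner ℝ a b = a 0 * b 0 + a 1 * b 1 := by
  simp [PiLp.inner_apply, Fin.sum_univ_two, mul_comm]

theorem norm_sq_plane (a : Plane) : ‖a‖ ^ 2 = a 0 * a 0 + a 1 * a 1 := by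
  rw [← real_inner_self_eq_norm_sq, inner_plane]

/-- Rotation by a right angle clockwise. -/
def rot (v : Plane) : Plane := !₂[v 1, -v 0]

@[simp] theorem rot_zero_apply (v : Plane) : rot v 0 = v 1 := rfl

@[simp] theorem rot_one_apply (v : Plane) : rot v 1 = -v 0 := rfl

theorem norm_rot (v : Plane) : ‖rot v‖ = ‖v‖ := by
  have h : ‖rot v‖ ^ 2 = ‖v‖ ^ 2 := by
    rw [norm_sq_plane, norm_sq_plane, rot_zero_apply, rot_one_apply]; ring
  exact (pow_left_inj₀ (norm_nonneg _) (norm_nonneg _) two_ne_zero).mp h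

theorem inner_rot_left (v w : Plane) : inner ℝ (rot v) w = -inner ℝ v (rot w) := by
  simp [inner_plane]

theorem inner_rot_self (v : Plane) : inner ℝ (rot v) v = 0 := by
  simp [inner_plane]; ring

theorem continuous_rot : Continuous rot := by
  have : rot = fun v : Plane => !₂[v 1, -v 0] := rfl
  rw [this]
  fun_prop

theorem inner_expand {T : Plane} (hT : ‖T‖ = 1) (v w : Plane) :
    inner ℝ v w = inner ℝ v T * inner ℝ w T + inner ℝ v (rot T) * inner ℝ w (rot T) := by
  have h := norm_sq_plane T
  rw [hT] at h
  simp only [inner_plane, rot_zero_apply, rot_one_apply]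
  linear_combination (v 0 * w 0 + v 1 * w 1) * h

theorem plane_ext {T : Plane} (hT : ‖T‖ = 1) {v w : Plane} (h₁ : inner ℝ v T = inner ℝ w T)
    (h₂ : inner ℝ v (rot T) = inner ℝ w (rot T)) : v = w := by
  refine ext_inner_right ℝ fun z => ?_
  rw [inner_expand hT v, inner_expand hT w, h₁, h₂]

theorem norm_sq_expand {T : Plane} (hT : ‖T‖ = 1) (v : Plane) :
    ‖v‖ ^ 2 = inner ℝ v T ^ 2 + inner ℝ v (rot T) ^ 2 := by
  rw [← real_inner_self_eq_norm_sq, inner_expand hT]; ring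

/-- Two unit vectors with the same component along the tangent `T` are either equal or mirror
images of each other in the line along `T`. -/
theorem eq_or_reflect {T e u : Plane} (hT : ‖T‖ = 1) (he : ‖e‖ = 1) (hu : ‖u‖ = 1)
    (h : inner ℝ e T = inner ℝ u T) :
    e = u ∨ (inner ℝ e (rot T) = -inner ℝ u (rot T) ∧
      u - e = (2 * inner ℝ u (rot T)) • rot T) := by
  have h1 := norm_sq_expand hT e
  have h2 := norm_sq_expand hT u
  rw [he] at h1
  rw [hu] at h2
  have h3 : inner ℝ e (rot T) ^ 2 = inner ℝ u (rot T) ^ 2 := by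
    rw [h] at h1; linarith
  rcases sq_eq_sq_iff_eq_or_eq_neg.mp h3 with h4 | h4
  · exact Or.inl (plane_ext hT h h4)
  · refine Or.inr ⟨h4, plane_ext hT ?_ ?_⟩
    · rw [inner_sub_left, h, inner_smul_left, inner_rot_self]; simp
    · rw [inner_sub_left, h4, inner_smul_left, real_inner_self_eq_norm_sq, norm_rot, hT]
      simp; ring

/-! ### Supporting lines, strict convexity and visibility. -/

namespace Obstacle

variable (Ω : Obstacle)

theorem hasDerivAt_γ (t : ℝ) : HasDerivAt Ω.γ (deriv Ω.γ t) t :=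
  (Ω.contDiff_γ.differentiable (by simp) t).hasDerivAt

theorem contDiff_deriv_γ : ContDiff ℝ ∞ (deriv Ω.γ) :=
  (contDiff_infty_iff_deriv.mp Ω.contDiff_γ).2

theorem hasDerivAt_deriv_γ (t : ℝ) : HasDerivAt (deriv Ω.γ) (iteratedDeriv 2 Ω.γ t) t := by
  rw [iteratedDeriv_succ, iteratedDeriv_one]
  exact (Ω.contDiff_deriv_γ.differentiable (by simp) t).hasDerivAt

theorem continuous_iteratedDeriv_γ : Continuous (iteratedDeriv 2 Ω.γ) :=
  (Ω.contDiff_γ.of_le (by norm_cast)).continuous_iteratedDeriv 2 le_rfl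

/-- The exterior unit normal at parameter `t`. -/
def nrm (t : ℝ) : Plane := rot (deriv Ω.γ t)

/-- The signed curvature at parameter `t`. -/
def curv (t : ℝ) : ℝ := -inner ℝ (Ω.nrm t) (iteratedDeriv 2 Ω.γ t)

theorem norm_nrm (t : ℝ) : ‖Ω.nrm t‖ = 1 := by rw [nrm, norm_rot, Ω.norm_deriv_γ]

theorem curv_pos (t : ℝ) : 0 < Ω.curv t := by
  have := Ω.curvature_pos t
  simp only [curv, nrm, inner_plane, rot_zero_apply, rot_one_apply]
  linarith

theorem continuous_nrm : Continuous Ω.nrm := continuous_rot.comp Ω.contDiff_deriv_γ.continuous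

theorem continuous_curv : Continuous Ω.curv :=
  (Ω.continuous_nrm.inner Ω.continuous_iteratedDeriv_γ).neg

/-- Frenet equation: differentiating `‖γ'‖² = 1` shows that `γ''` has no tangential part. -/
theorem iteratedDeriv_γ_eq (t : ℝ) : iteratedDeriv 2 Ω.γ t = -Ω.curv t • Ω.nrm t := by
  have hT := Ω.norm_deriv_γ t
  have h0 : inner ℝ (iteratedDeriv 2 Ω.γ t) (deriv Ω.γ t) = 0 := by
    have h1 := (Ω.hasDerivAt_deriv_γ t).inner ℝ (Ω.hasDerivAt_deriv_γ t)
    have h2 : (fun t => inner ℝ (deriv Ω.γ t) (deriv Ω.γ t)) = fun _ => (1 : ℝ) := by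
      funext s
      rw [real_inner_self_eq_norm_sq, Ω.norm_deriv_γ]; norm_num
    rw [h2] at h1
    have h3 := h1.unique (hasDerivAt_const t (1 : ℝ))
    rw [real_inner_comm] at h3
    linarith
  refine plane_ext hT ?_ ?_
  · rw [h0, inner_smul_left, nrm, inner_rot_self]; simp
  · rw [inner_smul_left, nrm, real_inner_self_eq_norm_sq, norm_rot, hT, curv, nrm, real_inner_comm]
    simp

theorem inner_iteratedDeriv_γ (v : Plane) (t : ℝ) :
    inner ℝ v (iteratedDeriv 2 Ω.γ t) = -Ω.curv t * inner ℝ v (Ω.nrm t) := by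
  rw [iteratedDeriv_γ_eq, inner_smul_right]

theorem frontier_subset : frontier Ω.body ⊆ Ω.body :=
  Ω.isCompact_body.isClosed.frontier_subset

theorem γ_mem_frontier (t : ℝ) : Ω.γ t ∈ frontier Ω.body := Ω.range_γ ▸ mem_range_self t

theorem γ_mem_body (t : ℝ) : Ω.γ t ∈ Ω.body := Ω.frontier_subset (Ω.γ_mem_frontier t)

theorem hasDerivAt_inner_γ (n : Plane) (t : ℝ) :
    HasDerivAt (fun t => inner ℝ n (Ω.γ t)) (inner ℝ n (deriv Ω.γ t)) t := by
  simpa using (hasDerivAt_const t n).inner ℝ (Ω.hasDerivAt_γ t)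

theorem hasDerivAt_inner_deriv_γ (n : Plane) (t : ℝ) :
    HasDerivAt (fun t => inner ℝ n (deriv Ω.γ t)) (inner ℝ n (iteratedDeriv 2 Ω.γ t)) t := by
  simpa using (hasDerivAt_const t n).inner ℝ (Ω.hasDerivAt_deriv_γ t)

theorem inner_deriv_eq_zero_of_max {n : Plane} {t₀ : ℝ}
    (h : ∀ t, inner ℝ n (Ω.γ t) ≤ inner ℝ n (Ω.γ t₀)) : inner ℝ n (deriv Ω.γ t₀) = 0 :=
  IsLocalMax.hasDerivAt_eq_zero (f := fun t => inner ℝ n (Ω.γ t))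
    (Filter.Eventually.of_forall h) (Ω.hasDerivAt_inner_γ n t₀)

theorem eq_smul_nrm {n : Plane} {t : ℝ} (h : inner ℝ n (deriv Ω.γ t) = 0) :
    n = inner ℝ n (Ω.nrm t) • Ω.nrm t := by
  refine plane_ext (Ω.norm_deriv_γ t) ?_ ?_
  · rw [h, inner_smul_left, nrm, inner_rot_self]; simp
  · rw [inner_smul_left, ← nrm, real_inner_self_eq_norm_sq, norm_nrm]; simp

/-- A vector whose scalar product with the curve is maximal at `γ t₀` is a positive multiple of the
exterior normal there. -/
theorem inner_nrm_pos_of_max {n : Plane} (hn : n ≠ 0) {t₀ : ℝ}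
    (h : ∀ t, inner ℝ n (Ω.γ t) ≤ inner ℝ n (Ω.γ t₀)) : 0 < inner ℝ n (Ω.nrm t₀) := by
  have h1 := Ω.inner_deriv_eq_zero_of_max h
  have h2 := Ω.eq_smul_nrm h1
  by_contra! hc
  rcases hc.eq_or_lt with hc | hc
  · rw [hc, zero_smul] at h2; exact hn h2
  -- If `n` pointed inwards, the curvature would make `t₀` a strict-type local minimum of `⟨n, γ⟩`
  -- besides a maximum. The function would be constant near `t₀`, and its derivative would vanish on
  -- a neighbourhood although the second derivative at `t₀` is nonzero.
  have h3 : 0 < inner ℝ n (iteratedDeriv 2 Ω.γ t₀) := by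
    rw [inner_iteratedDeriv_γ]
    exact mul_pos_of_neg_of_neg (neg_lt_zero.mpr (Ω.curv_pos t₀)) hc
  have h4 : deriv (fun t => inner ℝ n (Ω.γ t)) = fun t => inner ℝ n (deriv Ω.γ t) :=
    funext fun t => (Ω.hasDerivAt_inner_γ n t).deriv
  have h5 : IsLocalMin (fun t => inner ℝ n (Ω.γ t)) t₀ := by
    apply isLocalMin_of_deriv_deriv_pos
    · rw [h4, (Ω.hasDerivAt_inner_deriv_γ n t₀).deriv]; exact h3
    · rw [h4]; exact h1
    · exact (Ω.hasDerivAt_inner_γ n t₀).continuousAt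
  have h6 : ∀ᶠ t in 𝓝[≠] t₀, inner ℝ n (deriv Ω.γ t) = 0 := by
    filter_upwards [h5.filter_mono nhdsWithin_le_nhds] with t ht
    exact Ω.inner_deriv_eq_zero_of_max fun s => (h s).trans ht
  have h7 := (Ω.hasDerivAt_inner_deriv_γ n t₀).eventually_ne h3.ne' (c := 0)
  obtain ⟨t, ht1, ht2⟩ := (h6.and h7).exists
  exact ht2 ht1

/-- If the body lay in a line with normal `n`, then `⟨n, γ⟩` would be constant, so `n` and `-n`
would both be maximal at `γ 0` and both have positive product with the same normal. -/
theorem interior_nonempty : (interior Ω.body).Nonempty := by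
  rw [Ω.convex_body.interior_nonempty_iff_affineSpan_eq_top]
  by_contra hne
  have hmem : ∀ t, Ω.γ t ∈ affineSpan ℝ Ω.body := fun t => subset_affineSpan ℝ _ (Ω.γ_mem_body t)
  have hdir : (affineSpan ℝ Ω.body).direction ≠ ⊤ := by
    rwa [Ne, AffineSubspace.direction_eq_top_iff_of_nonempty ⟨_, hmem 0⟩]
  rw [Ne, ← Submodule.orthogonal_eq_bot_iff, ← Ne, Submodule.ne_bot_iff] at hdir
  obtain ⟨n, hn, hn0⟩ := hdir
  have hc : ∀ t, inner ℝ n (Ω.γ t) = inner ℝ n (Ω.γ 0) := fun t => by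
    have := Submodule.inner_left_of_mem_orthogonal
      (AffineSubspace.vsub_mem_direction (hmem t) (hmem 0)) hn
    rw [vsub_eq_sub, inner_sub_right] at this
    linarith
  have h1 := Ω.inner_nrm_pos_of_max hn0 (t₀ := 0) fun t => (hc t).le
  have h2 := Ω.inner_nrm_pos_of_max (neg_ne_zero.mpr hn0) (t₀ := 0) fun t => by
    rw [inner_neg_left, inner_neg_left, hc t]
  rw [inner_neg_left] at h2
  linarith

/-- A linear functional that attains its maximum over the body at a boundary point. -/
theorem exists_support {y : Plane} {S : Set Plane} (hS : Convex ℝ S)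
    (hyS : y ∈ closure S) (hyb : y ∈ Ω.body) (hdis : Disjoint (interior Ω.body) S) :
    ∃ n : Plane, n ≠ 0 ∧ (∀ z ∈ Ω.body, inner ℝ n z ≤ inner ℝ n y) ∧
      ∀ z ∈ S, inner ℝ n y ≤ inner ℝ n z := by
  have hSne : S.Nonempty := closure_nonempty_iff.mp ⟨y, hyS⟩
  obtain ⟨f, u, hf, h1, h2⟩ := geometric_hahn_banach_of_nonempty_interior Ω.convex_body hS hdis
    Ω.interior_nonempty hSne
  obtain ⟨n, rfl⟩ := (InnerProductSpace.toDual ℝ Plane).surjective f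
  have h3 : u = inner ℝ n y := by
    refine le_antisymm ?_ (by simpa using h1 y hyb)
    have : S ⊆ {z | u ≤ inner ℝ n z} := fun z hz => by simpa using h2 z hz
    exact closure_minimal this (isClosed_le continuous_const (by fun_prop)) hyS
  refine ⟨n, ?_, fun z hz => ?_, fun z hz => ?_⟩
  · rintro rfl; simp at hf
  · simpa [h3] using h1 z hz
  · simpa [h3] using h2 z hz

/-- A Hahn-Banach functional supporting the body at `γ t` is maximal there, hence a positive
multiple of `nrm t`. This is what makes the clockwise rotated tangent the exterior normal. -/
theorem inner_sub_le {t : ℝ} {z : Plane} (hz : z ∈ Ω.body) :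
    inner ℝ (z - Ω.γ t) (Ω.nrm t) ≤ 0 := by
  have ht := (Ω.γ_mem_frontier t).2
  obtain ⟨n, hn0, hn, -⟩ := Ω.exists_support (convex_singleton (Ω.γ t))
    (subset_closure rfl) (Ω.γ_mem_body t) (disjoint_singleton_right.mpr ht)
  have h1 := Ω.inner_nrm_pos_of_max hn0 fun s => hn _ (Ω.γ_mem_body s)
  have h2 := Ω.eq_smul_nrm (Ω.inner_deriv_eq_zero_of_max fun s => hn _ (Ω.γ_mem_body s))
  have h3 := hn z hz
  rw [h2, inner_smul_left, inner_smul_left] at h3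
  have h4 := le_of_mul_le_mul_left h3 (by simpa using h1)
  rw [inner_sub_left, real_inner_comm, real_inner_comm (Ω.nrm t)]
  linarith

/-- The body is strictly convex: it meets its tangent lines only at the point of tangency. -/
theorem inner_sub_neg {t : ℝ} {z : Plane} (hz : z ∈ Ω.body) (hne : z ≠ Ω.γ t) :
    inner ℝ (z - Ω.γ t) (Ω.nrm t) < 0 := by
  refine lt_of_le_of_ne (Ω.inner_sub_le hz) fun h0 => ?_
  set n := Ω.nrm t with hn
  set S := {s ∈ Icc 0 Ω.L | inner ℝ n (Ω.γ s) = inner ℝ n (Ω.γ t)} with hS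
  have hmax : ∀ w ∈ Ω.body, inner ℝ n w ≤ inner ℝ n (Ω.γ t) := fun w hw => by
    have := Ω.inner_sub_le (t := t) hw
    rw [inner_sub_left, real_inner_comm, real_inner_comm (Ω.nrm t)] at this
    linarith
  have hn0 : n ≠ 0 := by
    intro h; have := Ω.norm_nrm t; rw [← hn, h] at this; simp at this
  -- In the case of equality a whole segment of the supporting line belongs to the curve. Its
  -- infinitely many parameters in `[0, L]` accumulate at some `s`. They are all zeros of the
  -- derivative of `⟨n, γ⟩`, whose own derivative at `s` is nonzero by positive curvature.
  have hseg : segment ℝ (Ω.γ t) z ⊆ Ω.γ '' S := by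
    intro w hw
    have hwb : w ∈ Ω.body := Ω.convex_body.segment_subset (Ω.γ_mem_body t) hz hw
    have hwn : inner ℝ n w = inner ℝ n (Ω.γ t) := by
      rw [segment_eq_image'] at hw
      obtain ⟨θ, -, rfl⟩ := hw
      rw [inner_add_right, inner_smul_right, real_inner_comm (z - Ω.γ t) n, h0]; simp
    have hwf : w ∈ frontier Ω.body := by
      refine ⟨subset_closure hwb, fun hwi => ?_⟩
      obtain ⟨ε, hε, hball⟩ := Metric.isOpen_iff.mp isOpen_interior w hwi
      have h1 : w + (ε / 2) • n ∈ Metric.ball w ε := by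
        rw [Metric.mem_ball, dist_self_add_left, norm_smul, hn, norm_nrm, Real.norm_eq_abs,
          abs_of_pos (by positivity)]
        linarith
      have h2 := hmax _ (interior_subset (hball h1))
      rw [inner_add_right, inner_smul_right, real_inner_self_eq_norm_sq, hwn, hn, norm_nrm] at h2
      linarith
    obtain ⟨s, hs, hsw⟩ := Ω.exists_param ⟨w, hwf⟩
    have hsw' : Ω.γ s = w := congrArg Subtype.val hsw
    exact ⟨s, ⟨Ico_subset_Icc_self hs, by rw [hsw', hwn]⟩, hsw'⟩
  have hinf : S.Infinite := by
    refine Set.Infinite.of_image Ω.γ (Set.Infinite.mono hseg ?_)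
    rw [segment_eq_image']
    refine Set.Infinite.image ?_ (Icc_infinite one_pos)
    intro a _ b _ hab
    simp only [add_right_inj] at hab
    exact smul_left_injective ℝ (sub_ne_zero.mpr hne) hab
  obtain ⟨s, hs, hacc⟩ := hinf.exists_accPt_of_subset_isCompact isCompact_Icc (sep_subset _ _)
  have hclosed : IsClosed {s | inner ℝ n (Ω.γ s) = inner ℝ n (Ω.γ t)} :=
    isClosed_eq (continuous_const.inner Ω.contDiff_γ.continuous) continuous_const
  have hsmem : inner ℝ n (Ω.γ s) = inner ℝ n (Ω.γ t) :=
    isClosed_iff_clusterPt.mp hclosed s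
      (hacc.clusterPt.mono (principal_mono.mpr fun r hr => hr.2))
  have hpos := Ω.inner_nrm_pos_of_max hn0 (t₀ := s) fun r => by
    rw [hsmem]; exact hmax _ (Ω.γ_mem_body r)
  have hne2 : inner ℝ n (iteratedDeriv 2 Ω.γ s) ≠ 0 := by
    rw [inner_iteratedDeriv_γ]
    exact mul_ne_zero (neg_ne_zero.mpr (Ω.curv_pos s).ne') hpos.ne'
  have h7 := (Ω.hasDerivAt_inner_deriv_γ n s).eventually_ne hne2 (c := 0)
  obtain ⟨r, hr1, hr2⟩ := ((accPt_iff_frequently_nhdsNE.mp hacc).and_eventually h7).exists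
  exact hr2 (Ω.inner_deriv_eq_zero_of_max fun q => by
    rw [hr1.2]; exact hmax _ (Ω.γ_mem_body q))

/-- A point `y` of the curve is visible from an exterior point `x` if and only if `x` does not lie
strictly behind the tangent line at `y`. -/
theorem segment_inter_frontier_iff {x : Plane} (hx : x ∉ Ω.body) (t : ℝ) :
    segment ℝ x (Ω.γ t) ∩ frontier Ω.body = {Ω.γ t} ↔ 0 ≤ inner ℝ (x - Ω.γ t) (Ω.nrm t) := by
  constructor
  · intro h
    -- A point of the body inside the segment would, by connectedness, produce a frontier point
    -- between it and `x`, hence before `γ t`. So the open segment can be separated from the body,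
    -- and the separating functional is a positive multiple of the normal.
    have hdis : Disjoint Ω.body (openSegment ℝ x (Ω.γ t)) := by
      rw [Set.disjoint_left]
      intro w hwb hw
      have hwy : w ≠ Ω.γ t := by
        rintro rfl
        rw [right_mem_openSegment_iff] at hw
        exact hx (hw ▸ hwb)
      have hxw : (segment ℝ x w ∩ frontier Ω.body).Nonempty := by
        have := (convex_segment (𝕜 := ℝ) x w).isPreconnected
        by_contra! hemp
        have h3 : segment ℝ x w ⊆ interior Ω.body ∪ Ω.bodyᶜ := by
          intro p hp
          by_contra! hpn
          rw [mem_union, not_or, notMem_compl_iff] at hpn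
          exact (hemp ▸ (⟨hp, subset_closure hpn.2, hpn.1⟩ :
            p ∈ segment ℝ x w ∩ frontier Ω.body) : p ∈ (∅ : Set Plane))
        have hwi : w ∈ interior Ω.body :=
          (h3 (right_mem_segment ℝ x w)).resolve_right fun h => h hwb
        obtain ⟨p, -, hp1, hp2⟩ := this _ _ isOpen_interior
          Ω.isCompact_body.isClosed.isOpen_compl h3 ⟨w, right_mem_segment ℝ x w, hwi⟩
          ⟨x, left_mem_segment ℝ x w, hx⟩
        exact hp2 (interior_subset hp1)
      obtain ⟨p, hp, hpf⟩ := hxw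
      have hp' : p ∈ segment ℝ x (Ω.γ t) :=
        (convex_segment x (Ω.γ t)).segment_subset (left_mem_segment ℝ _ _)
          (openSegment_subset_segment ℝ _ _ hw) hp
      have hpy : p = Ω.γ t := by
        have : p ∈ segment ℝ x (Ω.γ t) ∩ frontier Ω.body := ⟨hp', hpf⟩
        rw [h] at this; exact this
      have h1 := mem_segment_iff_wbtw.mp hp
      have h2 := mem_segment_iff_wbtw.mp (openSegment_subset_segment ℝ _ _ hw)
      rw [hpy] at h1
      exact hwy ((wbtw_swap_right_iff ℝ x).mp ⟨h2, h1⟩)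
    have hcl : Ω.γ t ∈ closure (openSegment ℝ x (Ω.γ t)) :=
      segment_subset_closure_openSegment (right_mem_segment ℝ _ _)
    obtain ⟨n, hn0, hn, hn2⟩ := Ω.exists_support (convex_openSegment _ _) hcl
      (Ω.γ_mem_body t) (hdis.mono_left interior_subset)
    have h1 := Ω.inner_nrm_pos_of_max hn0 fun s => hn _ (Ω.γ_mem_body s)
    have h2 := Ω.eq_smul_nrm (Ω.inner_deriv_eq_zero_of_max fun s => hn _ (Ω.γ_mem_body s))
    have hx2 : inner ℝ n (Ω.γ t) ≤ inner ℝ n x := by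
      have : closure (openSegment ℝ x (Ω.γ t)) ⊆ {z | inner ℝ n (Ω.γ t) ≤ inner ℝ n z} :=
        closure_minimal hn2 (isClosed_le continuous_const (by fun_prop))
      exact this (segment_subset_closure_openSegment (left_mem_segment ℝ _ _))
    rw [h2, inner_smul_left, inner_smul_left] at hx2
    have h4 := le_of_mul_le_mul_left hx2 (by simpa using h1)
    rw [inner_sub_left, real_inner_comm, real_inner_comm (Ω.nrm t) (Ω.γ t)]
    linarith
  · intro h
    refine Subset.antisymm ?_ (singleton_subset_iff.mpr
      ⟨right_mem_segment ℝ _ _, Ω.γ_mem_frontier t⟩)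
    rintro w ⟨hw, hwf⟩
    by_contra hne
    have h1 := Ω.inner_sub_neg (Ω.frontier_subset hwf) hne
    rw [segment_symm, segment_eq_image'] at hw
    obtain ⟨θ, hθ, rfl⟩ := hw
    rw [add_sub_cancel_left, inner_smul_left] at h1
    have := mul_nonneg hθ.1 h
    simp at h1
    linarith

end Obstacle

/-! ### Calculus -/

theorem iteratedDeriv_two_eq {F : Type*} [NormedAddCommGroup F] [NormedSpace ℝ F] (f : ℝ → F) :
    iteratedDeriv 2 f = deriv (deriv f) := by
  rw [iteratedDeriv_succ, iteratedDeriv_one]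

theorem periodic_deriv {F : Type*} [NormedAddCommGroup F] [NormedSpace ℝ F] {f : ℝ → F} {L : ℝ}
    (hf : Function.Periodic f L) : Function.Periodic (deriv f) L := fun t => by
  rw [← deriv_comp_add_const]
  congr 1
  exact funext hf

/-- The implicit function theorem for one scalar equation. It is meant for the stationarity
equation, where `D` is the second derivative of the combined phase. -/
theorem exists_implicit {G : ℝ × ℝ → ℝ} {s₀ t₀ D : ℝ} (hG : ContDiffAt ℝ ∞ G (s₀, t₀))
    (hD : HasDerivAt (fun t => G (s₀, t)) D t₀) (hD0 : D ≠ 0) :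
    ∃ f : ℝ → ℝ, ContDiffAt ℝ ∞ f s₀ ∧ f s₀ = t₀ ∧ ∀ᶠ s in 𝓝 s₀, G (s, f s) = G (s₀, t₀) := by
  have hd : HasFDerivAt G (fderiv ℝ G (s₀, t₀)) (s₀, t₀) :=
    (hG.differentiableAt (by simp)).hasFDerivAt
  have h1 : HasFDerivAt (fun t => G (s₀, t))
      (fderiv ℝ G (s₀, t₀) ∘L .inr ℝ ℝ ℝ) t₀ :=
    hd.comp t₀ (hasFDerivAt_prodMk_right s₀ t₀)
  have h2 : fderiv ℝ G (s₀, t₀) ∘L .inr ℝ ℝ ℝ =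
      ((ContinuousLinearEquiv.unitsEquivAut ℝ (Units.mk0 D hD0) : ℝ ≃L[ℝ] ℝ) : ℝ →L[ℝ] ℝ) := by
    rw [h1.unique hD.hasFDerivAt]
    ext
    simp
  have hinv : (fderiv ℝ G (s₀, t₀) ∘L .inr ℝ ℝ ℝ).IsInvertible := ⟨_, h2.symm⟩
  exact ⟨hG.implicitFunction (by simp) hinv, hG.contDiffAt_implicitFunction (by simp) hinv,
    hG.implicitFunction_apply_self (by simp) hinv,
    hG.eventually_apply_implicitFunction (by simp) hinv⟩

theorem hasDerivAt_norm {F : ℝ → Plane} {F' : Plane} {s : ℝ} (hF : HasDerivAt F F' s)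
    (h0 : F s ≠ 0) : HasDerivAt (fun s => ‖F s‖) (inner ℝ (F s) F' / ‖F s‖) s := by
  have h1 := hF.norm_sq.sqrt (by positivity)
  simp only [Real.sqrt_sq (norm_nonneg _)] at h1
  refine h1.congr_deriv ?_
  have := norm_pos_iff.mpr h0
  field_simp

theorem inner_rot_rot (F V W : Plane) :
    inner ℝ (rot F) V * inner ℝ (rot F) W =
      ‖F‖ ^ 2 * inner ℝ V W - inner ℝ F V * inner ℝ F W := by
  rw [norm_sq_plane]
  simp only [inner_plane, rot_zero_apply, rot_one_apply]
  ring

/-- The derivative of `F / ‖F‖` sees only the part of `F'` perpendicular to `F`, that is, along `rot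
F`. -/
theorem hasDerivAt_inner_div_norm {F G : ℝ → Plane} {F' G' : Plane} {s : ℝ}
    (hF : HasDerivAt F F' s) (hG : HasDerivAt G G' s) (h0 : F s ≠ 0) :
    HasDerivAt (fun s => inner ℝ (F s) (G s) / ‖F s‖)
      (inner ℝ (F s) G' / ‖F s‖ +
        inner ℝ (rot (F s)) F' * inner ℝ (rot (F s)) (G s) / ‖F s‖ ^ 3) s := by
  have hp := norm_pos_iff.mpr h0
  have h1 := (hF.inner ℝ hG).div (hasDerivAt_norm hF h0) hp.ne'
  refine h1.congr_deriv ?_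
  rw [inner_rot_rot]
  field_simp
  ring

/-- The unit vector pointing from `y` to `x`. -/
def dirn (x y : Plane) : Plane := ‖x - y‖⁻¹ • (x - y)

theorem inner_dirn (x y v : Plane) : inner ℝ (dirn x y) v = inner ℝ (x - y) v / ‖x - y‖ := by
  rw [dirn, inner_smul_left, div_eq_inv_mul]; simp

theorem norm_dirn {x y : Plane} (h : x ≠ y) : ‖dirn x y‖ = 1 := by
  have := norm_pos_iff.mpr (sub_ne_zero.mpr h)
  rw [dirn, norm_smul, norm_inv, norm_norm, inv_mul_cancel₀ this.ne']

theorem norm_mul_dirn (x y v : Plane) :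
    ‖x - y‖ * inner ℝ (dirn x y) v = inner ℝ (x - y) v := by
  rw [inner_dirn]
  by_cases h : ‖x - y‖ = 0
  · rw [h, norm_eq_zero.mp h]; simp
  · field_simp

theorem inner_dirn_self (x y : Plane) : inner ℝ (dirn x y) (x - y) = ‖x - y‖ := by
  rw [inner_dirn, real_inner_self_eq_norm_sq]
  by_cases h : ‖x - y‖ = 0
  · rw [h]; simp
  · field_simp

/-! ### Functions of the boundary point and functions of its parameter. -/

namespace Obstacle

variable (Ω : Obstacle)

theorem pt_param (y : Ω.Boundary) : Ω.pt (Ω.param y) = y := (Ω.exists_param y).choose_spec.2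

theorem γ_param (y : Ω.Boundary) : Ω.γ (Ω.param y) = y := congrArg Subtype.val (Ω.pt_param y)

theorem mem_body (y : Ω.Boundary) : (y : Plane) ∈ Ω.body := Ω.frontier_subset y.2

/-- By injectivity on `[0, L)`, `param (pt t)` is `t` reduced modulo `L`, so periodic functions of
the parameter descend to the boundary. -/
theorem apply_param_pt {X : Type*} {f : ℝ → X} (hf : Function.Periodic f Ω.L) (t : ℝ) :
    f (Ω.param (Ω.pt t)) = f t := by
  have h2 : Ω.param (Ω.pt t) = toIcoMod Ω.L_pos 0 t := by
    refine Ω.injOn_γ (Ω.exists_param _).choose_spec.1 ?_ ?_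
    · simpa using toIcoMod_mem_Ico Ω.L_pos 0 t
    · rw [← self_sub_toIcoDiv_zsmul, Ω.periodic_γ.sub_zsmul_eq]; exact Ω.γ_param (Ω.pt t)
  rw [h2, ← self_sub_toIcoDiv_zsmul, hf.sub_zsmul_eq]

theorem periodic_pt : Function.Periodic Ω.pt Ω.L := fun t => Subtype.ext (Ω.periodic_γ t)

theorem periodic_nrm : Function.Periodic Ω.nrm Ω.L := fun t => by
  rw [nrm, nrm, periodic_deriv Ω.periodic_γ t]

theorem periodic_curv : Function.Periodic Ω.curv Ω.L := fun t => by
  rw [curv, curv, Ω.periodic_nrm t, iteratedDeriv_two_eq,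
    periodic_deriv (periodic_deriv Ω.periodic_γ) t]

/-- The curvature at a boundary point. -/
def kurv (y : Ω.Boundary) : ℝ := Ω.curv (Ω.param y)

theorem normal_pt (t : ℝ) : Ω.normal (Ω.pt t) = Ω.nrm t := Ω.apply_param_pt Ω.periodic_nrm t

theorem kurv_pt (t : ℝ) : Ω.kurv (Ω.pt t) = Ω.curv t := Ω.apply_param_pt Ω.periodic_curv t

theorem norm_normal (y : Ω.Boundary) : ‖Ω.normal y‖ = 1 := Ω.norm_nrm _

theorem kurv_pos (y : Ω.Boundary) : 0 < Ω.kurv y := Ω.curv_pos _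

theorem continuous_pt : Continuous Ω.pt := Ω.contDiff_γ.continuous.subtype_mk _

/-- The map `pt` from the compact interval `[0, L]` is closed and onto, hence a quotient map. This
gives continuity on the boundary although `param` itself jumps. -/
theorem continuous_of_comp_pt {X : Type*} [TopologicalSpace X] {f : Ω.Boundary → X}
    (hf : Continuous fun t => f (Ω.pt t)) : Continuous f := by
  have hc : Continuous fun t : Icc 0 Ω.L => Ω.pt t := Ω.continuous_pt.comp continuous_subtype_val
  have hs : Function.Surjective fun t : Icc 0 Ω.L => Ω.pt t := fun y => by
    obtain ⟨t, ht, hy⟩ := Ω.exists_param y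
    exact ⟨⟨t, Ico_subset_Icc_self ht⟩, hy⟩
  exact (hc.isClosedMap.isQuotientMap hc hs).continuous_iff.mpr (hf.comp continuous_subtype_val)

theorem continuous_normal : Continuous Ω.normal :=
  Ω.continuous_of_comp_pt (by simpa only [normal_pt] using Ω.continuous_nrm)

theorem continuous_kurv : Continuous Ω.kurv :=
  Ω.continuous_of_comp_pt (by simpa only [kurv_pt] using Ω.continuous_curv)

theorem segment_inter_frontier_iff' {x : Plane} (hx : x ∉ Ω.body) (y : Ω.Boundary) :
    segment ℝ x (y : Plane) ∩ frontier Ω.body = {(y : Plane)} ↔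
      0 ≤ inner ℝ (dirn x y) (Ω.normal y) := by
  have h := Ω.segment_inter_frontier_iff hx (Ω.param y)
  rw [γ_param] at h
  have hne : x ≠ y := fun h => hx (h ▸ Ω.mem_body y)
  have hp : 0 < ‖x - y‖ := norm_pos_iff.mpr (sub_ne_zero.mpr hne)
  rw [h, inner_dirn, le_div_iff₀ hp, zero_mul]
  rfl

theorem inner_sub_normal_neg {y : Ω.Boundary} {z : Plane} (hz : z ∈ Ω.body) (hne : z ≠ y) :
    inner ℝ (z - y) (Ω.normal y) < 0 := by
  have := Ω.inner_sub_neg (t := Ω.param y) hz (by rwa [γ_param])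
  rwa [γ_param] at this

end Obstacle

/-! ### One transmission -/

/-- A phase `φ` on a boundary curve that comes from a smooth field of rays: `e` is the field of
incoming directions, which are subgradients of `φ` and never point into the half plane given by `n`,
and `κ` is the curvature of the wave front. -/
structure Ray (Ω : Obstacle) (n : Plane) (φ : Ω.Boundary → ℝ) (e : Ω.Boundary → Plane)
    (κ : Ω.Boundary → ℝ) : Prop where
  smooth : ContDiff ℝ ∞ fun t => φ (Ω.pt t)
  norm_e : ∀ y, ‖e y‖ = 1
  subgrad : ∀ y z : Ω.Boundary, φ y + inner ℝ (e y) ((z : Plane) - y) ≤ φ z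
  inner_n : ∀ y, inner ℝ (e y) n ≤ 0
  κ_nonneg : ∀ y, 0 ≤ κ y
  second : ∀ t, iteratedDeriv 2 (fun t => φ (Ω.pt t)) t =
    κ (Ω.pt t) * inner ℝ (e (Ω.pt t)) (Ω.nrm t) ^ 2 - Ω.curv t * inner ℝ (e (Ω.pt t)) (Ω.nrm t)

/-- The obstacle `Λ` lies in the direction `n`, as seen from the obstacle `Ω`. -/
structure Sep (Ω Λ : Obstacle) (n : Plane) (c : ℝ) : Prop where
  pos : 0 < c
  norm_n : ‖n‖ = 1
  le : ∀ x ∈ Λ.body, ∀ y ∈ Ω.body, c * ‖x - y‖ ≤ inner ℝ (x - y) n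
  ne : ∀ x ∈ Λ.body, ∀ y ∈ Ω.body, x ≠ y

variable {Ω Λ : Obstacle} {n : Plane} {c : ℝ} {φ : Ω.Boundary → ℝ} {e : Ω.Boundary → Plane}
  {κ : Ω.Boundary → ℝ}

namespace Ray

/-- The subgradient inequality says that `φ - ⟨e, ·⟩` has a minimum along the curve at `t`. -/
theorem deriv_eq_of_subgrad {e : Plane} {t : ℝ}
    (hφ : DifferentiableAt ℝ (fun t => φ (Ω.pt t)) t)
    (h : ∀ z : Ω.Boundary, φ (Ω.pt t) + inner ℝ e ((z : Plane) - Ω.γ t) ≤ φ z) :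
    deriv (fun t => φ (Ω.pt t)) t = inner ℝ e (deriv Ω.γ t) := by
  have h2 := hφ.hasDerivAt.sub (Ω.hasDerivAt_inner_γ e t)
  have h3 := IsLocalMin.hasDerivAt_eq_zero (Filter.Eventually.of_forall fun s => ?_) h2
  · linarith
  · have := h (Ω.pt s)
    rw [inner_sub_right] at this
    change φ (Ω.pt t) - inner ℝ e (Ω.γ t) ≤ φ (Ω.pt s) - inner ℝ e (Ω.γ s)
    have h4 : ((Ω.pt s : Plane)) = Ω.γ s := rfl
    rw [h4] at this
    linarith

theorem deriv_eq (hR : Ray Ω n φ e κ) (t : ℝ) :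
    deriv (fun t => φ (Ω.pt t)) t = inner ℝ (e (Ω.pt t)) (deriv Ω.γ t) :=
  deriv_eq_of_subgrad (hR.smooth.differentiable (by simp) t) fun z => hR.subgrad (Ω.pt t) z

theorem le_add_norm (hR : Ray Ω n φ e κ) (y z : Ω.Boundary) :
    φ y ≤ φ z + ‖(z : Plane) - y‖ := by
  have h1 := hR.subgrad y z
  have h2 := neg_le_of_abs_le (abs_real_inner_le_norm (e y) ((z : Plane) - y))
  rw [hR.norm_e, one_mul] at h2
  linarith

theorem continuous_phase (hR : Ray Ω n φ e κ) : Continuous φ :=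
  Ω.continuous_of_comp_pt hR.smooth.continuous

theorem hasDerivAt_phase (hR : Ray Ω n φ e κ) (t : ℝ) :
    HasDerivAt (fun t => φ (Ω.pt t)) (deriv (fun t => φ (Ω.pt t)) t) t :=
  (hR.smooth.differentiable (by simp) t).hasDerivAt

theorem hasDerivAt_combinedPhase (hR : Ray Ω n φ e κ) {x : Plane} {t : ℝ} (hx : x ≠ Ω.γ t) :
    HasDerivAt (combinedPhase Ω φ x)
      (deriv (fun t => φ (Ω.pt t)) t - inner ℝ (x - Ω.γ t) (deriv Ω.γ t) / ‖x - Ω.γ t‖) t := by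
  have h1 := hasDerivAt_norm ((Ω.hasDerivAt_γ t).const_sub x) (sub_ne_zero.mpr hx)
  have h2 := (hR.hasDerivAt_phase t).add h1
  rw [inner_neg_right, neg_div, ← sub_eq_add_neg] at h2
  exact h2

theorem hasDerivAt_deriv_phase (hR : Ray Ω n φ e κ) (t : ℝ) :
    HasDerivAt (deriv fun t => φ (Ω.pt t)) (iteratedDeriv 2 (fun t => φ (Ω.pt t)) t) t := by
  rw [iteratedDeriv_two_eq]
  exact ((contDiff_infty_iff_deriv.mp hR.smooth).2.differentiable (by simp) t).hasDerivAt

theorem sq_inner_rot (F : Plane) (t : ℝ) :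
    inner ℝ (rot F) (deriv Ω.γ t) ^ 2 = inner ℝ F (Ω.nrm t) ^ 2 := by
  rw [inner_rot_left, neg_sq]; rfl

/-- The value of the second derivative of the combined phase. -/
theorem hasDerivAt_deriv_combinedPhase (hR : Ray Ω n φ e κ) {x : Plane} {t : ℝ} (hx : x ≠ Ω.γ t) :
    HasDerivAt (fun t => deriv (fun t => φ (Ω.pt t)) t -
        inner ℝ (x - Ω.γ t) (deriv Ω.γ t) / ‖x - Ω.γ t‖)
      (iteratedDeriv 2 (fun t => φ (Ω.pt t)) t + Ω.curv t * inner ℝ (dirn x (Ω.γ t)) (Ω.nrm t) +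
        inner ℝ (dirn x (Ω.γ t)) (Ω.nrm t) ^ 2 / ‖x - Ω.γ t‖) t := by
  have h1 := hasDerivAt_inner_div_norm ((Ω.hasDerivAt_γ t).const_sub x) (Ω.hasDerivAt_deriv_γ t)
    (sub_ne_zero.mpr hx)
  have hp := norm_pos_iff.mpr (sub_ne_zero.mpr hx)
  refine ((hR.hasDerivAt_deriv_phase t).sub h1).congr_deriv ?_
  rw [inner_neg_right, neg_mul, ← sq, sq_inner_rot, Ω.inner_iteratedDeriv_γ, inner_dirn]
  field_simp
  ring

theorem iteratedDeriv_combinedPhase (hR : Ray Ω n φ e κ) {x : Plane} (hx : x ∉ Ω.body) (t : ℝ) :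
    iteratedDeriv 2 (combinedPhase Ω φ x) t =
      iteratedDeriv 2 (fun t => φ (Ω.pt t)) t + Ω.curv t * inner ℝ (dirn x (Ω.γ t)) (Ω.nrm t) +
        inner ℝ (dirn x (Ω.γ t)) (Ω.nrm t) ^ 2 / ‖x - Ω.γ t‖ := by
  have hne : ∀ t, x ≠ Ω.γ t := fun t h => hx (h ▸ Ω.γ_mem_body t)
  rw [iteratedDeriv_two_eq, funext fun t => (hR.hasDerivAt_combinedPhase (hne t)).deriv]
  exact (hR.hasDerivAt_deriv_combinedPhase (hne t)).deriv

end Ray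

theorem Sep.notMem (hS : Sep Ω Λ n c) {x : Plane} (hx : x ∈ Λ.body) : x ∉ Ω.body :=
  fun h => hS.ne x hx x h rfl

theorem Sep.le_inner_dirn (hS : Sep Ω Λ n c) {x y : Plane} (hx : x ∈ Λ.body) (hy : y ∈ Ω.body) :
    c ≤ inner ℝ (dirn x y) n := by
  have hp := norm_pos_iff.mpr (sub_ne_zero.mpr (hS.ne x hx y hy))
  rw [inner_dirn, le_div_iff₀ hp]
  exact hS.le x hx y hy

namespace Ray

theorem deriv_combinedPhase_param (hR : Ray Ω n φ e κ) {x : Plane} (hx : x ∉ Ω.body)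
    (y : Ω.Boundary) :
    deriv (combinedPhase Ω φ x) (Ω.param y) = inner ℝ (e y) (deriv Ω.γ (Ω.param y)) -
      inner ℝ (dirn x y) (deriv Ω.γ (Ω.param y)) := by
  have hne : x ≠ Ω.γ (Ω.param y) := fun h => hx (h ▸ Ω.γ_mem_body _)
  rw [(hR.hasDerivAt_combinedPhase hne).deriv, hR.deriv_eq,
    Ω.pt_param, Ω.γ_param, inner_dirn]

/-- The law of reflection at a target point, with a uniform bound on the angle. -/
theorem isTarget_iff (hR : Ray Ω n φ e κ) (hS : Sep Ω Λ n c) {x : Plane} (hx : x ∈ Λ.body)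
    (y : Ω.Boundary) : IsTarget Ω φ x y ↔
      dirn x y - e y = (2 * inner ℝ (dirn x y) (Ω.normal y)) • Ω.normal y ∧
        inner ℝ (e y) (Ω.normal y) = -inner ℝ (dirn x y) (Ω.normal y) ∧
        c ≤ 2 * inner ℝ (dirn x y) (Ω.normal y) := by
  have hxb := hS.notMem hx
  have hT := Ω.norm_deriv_γ (Ω.param y)
  have hN : Ω.normal y = rot (deriv Ω.γ (Ω.param y)) := rfl
  rw [IsTarget, Ω.segment_inter_frontier_iff' hxb, hR.deriv_combinedPhase_param hxb, sub_eq_zero]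
  constructor
  · rintro ⟨h1, h2⟩
    have h5 := hS.le_inner_dirn hx (Ω.mem_body y)
    -- The ray to `x` advances by at least `c` in the direction `n`, the incoming ray does not
    -- advance. This excludes the ray that continues straight on, and for the mirrored one it bounds
    -- the cosine.
    have hue : c ≤ inner ℝ (dirn x y - e y) n := by
      rw [inner_sub_left]
      linarith [hR.inner_n y]
    rcases eq_or_reflect hT (hR.norm_e y) (norm_dirn (hS.ne x hx y (Ω.mem_body y))) h1 with h3 | h3
    · rw [h3, sub_self, inner_zero_left] at hue
      exact absurd hue (not_le.mpr hS.pos)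
    · refine ⟨h3.2, h3.1, ?_⟩
      rw [h3.2, ← hN, inner_smul_left] at hue
      have h6 : inner ℝ (Ω.normal y) n ≤ 1 := by
        have := real_inner_le_norm (Ω.normal y) n
        rwa [Ω.norm_normal, hS.norm_n, one_mul] at this
      refine hue.trans ?_
      simp only [conj_trivial]
      have h7 : 0 ≤ 2 * inner ℝ (dirn x y) (Ω.normal y) := by linarith
      nlinarith
  · rintro ⟨h1, -, h2⟩
    have h3 := congrArg (fun v => inner ℝ v (deriv Ω.γ (Ω.param y))) h1
    simp only [inner_sub_left, inner_smul_left] at h3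
    rw [hN, inner_rot_self, mul_zero] at h3
    exact ⟨by linarith, by linarith [hS.pos]⟩

/-- The combined phase at an arbitrary boundary point, compared with a target point. -/
theorem add_le_of_isTarget (hR : Ray Ω n φ e κ) (hS : Sep Ω Λ n c) {x : Plane} (hx : x ∈ Λ.body)
    {y : Ω.Boundary} (hy : IsTarget Ω φ x y) (z : Ω.Boundary) (x' : Plane) :
    φ y + ‖x - y‖ + inner ℝ (dirn x y) (x' - x) -
      2 * inner ℝ (dirn x y) (Ω.normal y) * inner ℝ ((z : Plane) - y) (Ω.normal y) ≤
      φ z + ‖x' - z‖ := by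
  obtain ⟨h1, -, h2⟩ := (hR.isTarget_iff hS hx y).mp hy
  have h3 := hR.subgrad y z
  have h4 : inner ℝ (dirn x y) (x' - z) ≤ ‖x' - z‖ := by
    have := real_inner_le_norm (dirn x y) (x' - z)
    rwa [norm_dirn (hS.ne x hx y (Ω.mem_body y)), one_mul] at this
  have h5 : e y = dirn x y - (2 * inner ℝ (dirn x y) (Ω.normal y)) • Ω.normal y := by
    rw [← h1, sub_sub_cancel]
  have h6 := inner_dirn_self x y
  rw [h5, inner_sub_left, inner_smul_left, real_inner_comm ((z : Plane) - y) (Ω.normal y)] at h3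
  have h7 : x' - (z : Plane) = (x' - x) + (x - y) - (z - y) := by abel
  rw [h7, inner_sub_right, inner_add_right, h6, ← h7] at h4
  simp only [conj_trivial] at h3
  linarith

/-- Convexity gives the normal term of `add_le_of_isTarget` a favourable sign. For `x' = x` this
says that the target minimizes the combined phase; for `z` the target of `x'` it is the subgradient
inequality of the transmitted phase. -/
theorem le_of_isTarget (hR : Ray Ω n φ e κ) (hS : Sep Ω Λ n c) {x : Plane} (hx : x ∈ Λ.body)
    {y : Ω.Boundary} (hy : IsTarget Ω φ x y) (z : Ω.Boundary) (x' : Plane) :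
    φ y + ‖x - y‖ + inner ℝ (dirn x y) (x' - x) ≤ φ z + ‖x' - z‖ := by
  have h1 := hR.add_le_of_isTarget hS hx hy z x'
  obtain ⟨-, -, h2⟩ := (hR.isTarget_iff hS hx y).mp hy
  have h3 : inner ℝ ((z : Plane) - y) (Ω.normal y) ≤ 0 := by
    rcases eq_or_ne z y with rfl | h
    · simp
    · exact (Ω.inner_sub_normal_neg (Ω.mem_body z) fun h' => h (Subtype.ext h')).le
  have h4 := hS.pos
  nlinarith

/-- Each of two targets would minimize the combined phase, but strict convexity makes the inequality
strict away from `y`. -/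
theorem isTarget_unique (hR : Ray Ω n φ e κ) (hS : Sep Ω Λ n c) {x : Plane} (hx : x ∈ Λ.body)
    {y z : Ω.Boundary} (hy : IsTarget Ω φ x y) (hz : IsTarget Ω φ x z) : z = y := by
  by_contra hne
  have h1 := hR.add_le_of_isTarget hS hx hy z x
  have h2 := hR.le_of_isTarget hS hx hz y x
  obtain ⟨-, -, h3⟩ := (hR.isTarget_iff hS hx y).mp hy
  have h4 := Ω.inner_sub_normal_neg (y := y) (Ω.mem_body z) fun h' => hne (Subtype.ext h')
  rw [sub_self, inner_zero_right] at h1 h2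
  have h5 := hS.pos
  nlinarith

/-- A minimizer `y` exists by compactness but may be hidden. The point `z` of the curve on `[x, y]`
nearest to `x` is visible, and it is also a minimizer because `φ` grows by at most the distance
(`le_add_norm`). -/
theorem exists_isTarget (hR : Ray Ω n φ e κ) (x : Plane) :
    ∃ y, IsTarget Ω φ x y := by
  have hcont : Continuous fun y : Ω.Boundary => φ y + ‖x - y‖ :=
    hR.continuous_phase.add (by fun_prop)
  obtain ⟨y, -, hy⟩ := isCompact_univ.exists_isMinOn univ_nonempty hcont.continuousOn
  have hK : IsCompact (segment ℝ x (y : Plane) ∩ frontier Ω.body) := by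
    have h1 : IsCompact (segment ℝ x (y : Plane)) := by
      rw [segment_eq_image']
      exact isCompact_Icc.image (by fun_prop)
    exact h1.inter_right isClosed_frontier
  obtain ⟨z, ⟨hz, hzf⟩, hmin⟩ := hK.exists_isMinOn ⟨y, right_mem_segment ℝ _ _, y.2⟩
    (f := fun z => ‖x - z‖) (by fun_prop)
  have hzmin : ∀ w : Ω.Boundary, φ ⟨z, hzf⟩ + ‖x - z‖ ≤ φ w + ‖x - w‖ := fun w => by
    have h1 : φ y + ‖x - y‖ ≤ φ w + ‖x - w‖ := hy (mem_univ w)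
    have h2 := hR.le_add_norm ⟨z, hzf⟩ y
    have h3 := dist_add_dist_of_mem_segment hz
    rw [dist_eq_norm, dist_eq_norm, dist_eq_norm, norm_sub_rev z] at h3
    simp only at h2
    linarith
  refine ⟨⟨z, hzf⟩, ?_, ?_⟩
  · refine IsLocalMin.deriv_eq_zero (Filter.Eventually.of_forall fun t => ?_)
    have := hzmin (Ω.pt t)
    simp only [combinedPhase, Ω.pt_param, Ω.γ_param]
    exact this
  · refine Subset.antisymm ?_ (singleton_subset_iff.mpr ⟨right_mem_segment ℝ _ _, hzf⟩)
    rintro w ⟨hw, hwf⟩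
    have h1 : ‖x - z‖ ≤ ‖x - w‖ := hmin
      ⟨(convex_segment x (y : Plane)).segment_subset (left_mem_segment ℝ _ _) hz hw, hwf⟩
    have h3 := dist_add_dist_of_mem_segment hw
    rw [dist_eq_norm, dist_eq_norm, dist_eq_norm] at h3
    have h4 : ‖w - z‖ = 0 := le_antisymm (by linarith) (norm_nonneg _)
    exact sub_eq_zero.mp (norm_eq_zero.mp h4)

theorem isTarget_target (hR : Ray Ω n φ e κ) (x : Plane) : IsTarget Ω φ x (target Ω φ x) :=
  Classical.epsilon_spec (hR.exists_isTarget x)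

theorem target_eq (hR : Ray Ω n φ e κ) (hS : Sep Ω Λ n c) {x : Plane} (hx : x ∈ Λ.body)
    {y : Ω.Boundary} (hy : IsTarget Ω φ x y) : target Ω φ x = y :=
  hR.isTarget_unique hS hx hy (hR.isTarget_target x)

/-- The second derivative at a target point, in terms of the curvatures of the obstacle and of the
wave front. -/
theorem secondDeriv_eq (hR : Ray Ω n φ e κ) (hS : Sep Ω Λ n c) {x : Plane} (hx : x ∈ Λ.body)
    {y : Ω.Boundary} (hy : IsTarget Ω φ x y) :
    secondDeriv Ω φ x y = inner ℝ (dirn x y) (Ω.normal y) ^ 2 *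
      (κ y + 2 * Ω.kurv y / inner ℝ (dirn x y) (Ω.normal y) + 1 / ‖x - y‖) := by
  obtain ⟨-, h1, h2⟩ := (hR.isTarget_iff hS hx y).mp hy
  have h3 := hS.pos
  have h4 : 0 < inner ℝ (dirn x y) (Ω.normal y) := by linarith
  have hN : Ω.nrm (Ω.param y) = Ω.normal y := rfl
  have hK : Ω.curv (Ω.param y) = Ω.kurv y := rfl
  rw [secondDeriv, hR.iteratedDeriv_combinedPhase (hS.notMem hx), hR.second, Ω.pt_param,
    Ω.γ_param, hN, hK, h1]
  field_simp
  ring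

theorem secondDeriv_pos (hR : Ray Ω n φ e κ) (hS : Sep Ω Λ n c) {x : Plane} (hx : x ∈ Λ.body)
    {y : Ω.Boundary} (hy : IsTarget Ω φ x y) : 0 < secondDeriv Ω φ x y := by
  rw [hR.secondDeriv_eq hS hx hy]
  obtain ⟨-, h1, h2⟩ := (hR.isTarget_iff hS hx y).mp hy
  have h3 := hS.pos
  have h4 : 0 < inner ℝ (dirn x y) (Ω.normal y) := by linarith
  have h5 := norm_pos_iff.mpr (sub_ne_zero.mpr (hS.ne x hx y (Ω.mem_body y)))
  have h6 := hR.κ_nonneg y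
  have h7 := Ω.kurv_pos y
  positivity

theorem admissible (hR : Ray Ω n φ e κ) (hS : Sep Ω Λ n c) : Admissible Ω Λ φ :=
  ⟨hR.smooth, fun x => ⟨⟨target Ω φ x, hR.isTarget_target x, fun _ hz =>
    hR.isTarget_unique hS (Λ.mem_body x) (hR.isTarget_target x) hz⟩,
    fun _ hy => hR.secondDeriv_pos hS (Λ.mem_body x) hy⟩⟩

end Ray

/-! ### The transmitted wave front: smoothness, direction and curvature. -/

variable {Ω Λ : Obstacle} {n : Plane} {c : ℝ} {φ : Ω.Boundary → ℝ} {e : Ω.Boundary → Plane}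
  {κ : Ω.Boundary → ℝ}

/-- The curvature that the reflection at `y` into the direction of `x` adds to a wave front. -/
def bend (Ω : Obstacle) (x : Plane) (y : Ω.Boundary) : ℝ :=
  2 * Ω.kurv y / inner ℝ (dirn x y) (Ω.normal y)

/-- The direction in which the transmitted wave arrives at `x`. -/
def nextDir (Ω : Obstacle) (φ : Ω.Boundary → ℝ) (x : Plane) : Plane := dirn x (target Ω φ x)

/-- The curvature of the transmitted wave front at `x`. -/
def nextCurv (Ω : Obstacle) (φ : Ω.Boundary → ℝ) (κ : Ω.Boundary → ℝ) (x : Plane) : ℝ :=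
  (κ (target Ω φ x) + bend Ω x (target Ω φ x)) /
    (1 + ‖x - target Ω φ x‖ * (κ (target Ω φ x) + bend Ω x (target Ω φ x)))

namespace Ray

theorem cos_pos (hR : Ray Ω n φ e κ) (hS : Sep Ω Λ n c) {x : Plane} (hx : x ∈ Λ.body) :
    0 < inner ℝ (dirn x (target Ω φ x)) (Ω.normal (target Ω φ x)) := by
  have h1 := ((hR.isTarget_iff hS hx _).mp (hR.isTarget_target x)).2.2
  linarith [hS.pos]

theorem contDiffAt_stationary (hR : Ray Ω n φ e κ) (s t : ℝ) (h : Λ.γ s ≠ Ω.γ t) :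
    ContDiffAt ℝ ∞ (fun p : ℝ × ℝ => deriv (fun t => φ (Ω.pt t)) p.2 -
      inner ℝ (Λ.γ p.1 - Ω.γ p.2) (deriv Ω.γ p.2) / ‖Λ.γ p.1 - Ω.γ p.2‖) (s, t) := by
  have h0 : ContDiff ℝ ∞ (deriv fun t => φ (Ω.pt t)) := (contDiff_infty_iff_deriv.mp hR.smooth).2
  have h1 : ContDiff ℝ ∞ fun p : ℝ × ℝ => Λ.γ p.1 - Ω.γ p.2 :=
    (Λ.contDiff_γ.comp contDiff_fst).sub (Ω.contDiff_γ.comp contDiff_snd)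
  have h2 : Λ.γ s - Ω.γ t ≠ 0 := sub_ne_zero.mpr h
  exact (h0.comp contDiff_snd).contDiffAt.sub
    ((h1.inner ℝ (Ω.contDiff_deriv_γ.comp contDiff_snd)).contDiffAt.div
      (h1.contDiffAt.norm ℝ h2) (norm_ne_zero_iff.mpr h2))

/-- Locally, the target point is a smooth function of the arc length parameter. -/
theorem exists_local_target (hR : Ray Ω n φ e κ) (hS : Sep Ω Λ n c) (s₀ : ℝ) :
    ∃ f : ℝ → ℝ, ContDiffAt ℝ ∞ f s₀ ∧ (∀ᶠ s in 𝓝 s₀, target Ω φ (Λ.γ s) = Ω.pt (f s)) ∧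
      ∀ᶠ s in 𝓝 s₀, deriv (fun t => φ (Ω.pt t)) (f s) -
        inner ℝ (Λ.γ s - Ω.γ (f s)) (deriv Ω.γ (f s)) / ‖Λ.γ s - Ω.γ (f s)‖ = 0 := by
  have hx := Λ.γ_mem_body s₀
  have htar := hR.isTarget_target (Λ.γ s₀)
  set y := target Ω φ (Λ.γ s₀) with hy
  have hne : Λ.γ s₀ ≠ Ω.γ (Ω.param y) := hS.ne _ hx _ (Ω.γ_mem_body _)
  have hG := hR.contDiffAt_stationary s₀ (Ω.param y) hne
  have hD := hR.hasDerivAt_deriv_combinedPhase hne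
  rw [← hR.iteratedDeriv_combinedPhase (hS.notMem hx)] at hD
  obtain ⟨f, hf, hf0, hfG⟩ := exists_implicit hG hD (hR.secondDeriv_pos hS hx htar).ne'
  have hzero : deriv (fun t => φ (Ω.pt t)) (Ω.param y) - inner ℝ (Λ.γ s₀ - Ω.γ (Ω.param y))
      (deriv Ω.γ (Ω.param y)) / ‖Λ.γ s₀ - Ω.γ (Ω.param y)‖ = 0 := by
    rw [← (hR.hasDerivAt_combinedPhase hne).deriv]; exact htar.1
  simp only [hzero] at hfG
  -- The implicit function gives stationary points. They are targets because visibility, with a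
  -- strictly positive cosine at `s₀`, is an open condition.
  have hpos : ∀ᶠ s in 𝓝 s₀, 0 < inner ℝ (Λ.γ s - Ω.γ (f s)) (Ω.nrm (f s)) := by
    have hcont : ContinuousAt (fun s => inner ℝ (Λ.γ s - Ω.γ (f s)) (Ω.nrm (f s))) s₀ := by
      have h1 : ContinuousAt (fun s => Ω.γ (f s)) s₀ :=
        Ω.contDiff_γ.continuous.continuousAt.comp hf.continuousAt
      have h2 : ContinuousAt (fun s => Ω.nrm (f s)) s₀ :=
        Ω.continuous_nrm.continuousAt.comp hf.continuousAt
      exact (Λ.contDiff_γ.continuous.continuousAt.sub h1).inner h2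
    refine hcont.eventually_const_lt ?_
    have h3 := hR.cos_pos hS hx
    rw [← hy] at h3
    have h4 : 0 < ‖Λ.γ s₀ - y‖ := norm_pos_iff.mpr (sub_ne_zero.mpr (hS.ne _ hx _ (Ω.mem_body y)))
    have h5 := mul_pos h4 h3
    rw [norm_mul_dirn] at h5
    simp only [hf0, Ω.γ_param]
    exact h5
  refine ⟨f, hf, ?_, hfG⟩
  filter_upwards [hfG, hpos] with s h1 h2
  have hxs := Λ.γ_mem_body s
  refine hR.target_eq hS hxs ⟨?_, ?_⟩
  · rw [hR.deriv_combinedPhase_param (hS.notMem hxs), inner_dirn,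
      Ω.apply_param_pt (periodic_deriv Ω.periodic_γ), ← hR.deriv_eq]
    exact h1
  · exact (Ω.segment_inter_frontier_iff (hS.notMem hxs) (f s)).mpr h2.le

theorem continuous_target (hR : Ray Ω n φ e κ) (hS : Sep Ω Λ n c) :
    Continuous fun x : Λ.Boundary => target Ω φ x := by
  refine Λ.continuous_of_comp_pt (continuous_iff_continuousAt.mpr fun s => ?_)
  obtain ⟨f, hf, hft, -⟩ := hR.exists_local_target hS s
  have h1 : ContinuousAt (fun s => Ω.pt (f s)) s := Ω.continuous_pt.continuousAt.comp hf.continuousAt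
  exact h1.congr (hft.mono fun _ h => h.symm)

theorem contDiff_transPhase (hR : Ray Ω n φ e κ) (hS : Sep Ω Λ n c) :
    ContDiff ℝ ∞ fun s => transPhase Ω Λ φ (Λ.pt s) := by
  refine contDiff_iff_contDiffAt.mpr fun s => ?_
  obtain ⟨f, hf, hft, -⟩ := hR.exists_local_target hS s
  have h1 : ContDiffAt ℝ ∞ (fun s => φ (Ω.pt (f s)) + ‖Λ.γ s - Ω.γ (f s)‖) s := by
    have h2 : ContDiffAt ℝ ∞ (fun s => φ (Ω.pt (f s))) s :=
      hR.smooth.contDiffAt.comp s hf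
    have h3 : ContDiffAt ℝ ∞ (fun s => Ω.γ (f s)) s := Ω.contDiff_γ.contDiffAt.comp s hf
    exact h2.add ((Λ.contDiff_γ.contDiffAt.sub h3).norm ℝ
      (sub_ne_zero.mpr (hS.ne _ (Λ.γ_mem_body s) _ (Ω.γ_mem_body _))))
  refine h1.congr_of_eventuallyEq ?_
  filter_upwards [hft] with r hr
  have : ((Λ.pt r : Plane)) = Λ.γ r := rfl
  rw [transPhase, this, hr]
  rfl

theorem transPhase_subgrad (hR : Ray Ω n φ e κ) (hS : Sep Ω Λ n c) (x z : Λ.Boundary) :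
    transPhase Ω Λ φ x + inner ℝ (nextDir Ω φ x) ((z : Plane) - x) ≤ transPhase Ω Λ φ z :=
  hR.le_of_isTarget hS (Λ.mem_body x) (hR.isTarget_target _) _ _

theorem transPhase_le (hR : Ray Ω n φ e κ) (hS : Sep Ω Λ n c) (x : Λ.Boundary) (y : Ω.Boundary) :
    transPhase Ω Λ φ x ≤ φ y + ‖(x : Plane) - y‖ := by
  simpa [transPhase] using hR.le_of_isTarget hS (Λ.mem_body x) (hR.isTarget_target _) y x

theorem deriv_transPhase (hR : Ray Ω n φ e κ) (hS : Sep Ω Λ n c) (s : ℝ) :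
    deriv (fun s => transPhase Ω Λ φ (Λ.pt s)) s =
      inner ℝ (nextDir Ω φ (Λ.γ s)) (deriv Λ.γ s) :=
  deriv_eq_of_subgrad ((hR.contDiff_transPhase hS).differentiable (by simp) s)
    fun z => hR.transPhase_subgrad hS (Λ.pt s) z

theorem one_add_pos (hR : Ray Ω n φ e κ) (hS : Sep Ω Λ n c) {x : Plane} (hx : x ∈ Λ.body) :
    0 < κ (target Ω φ x) + bend Ω x (target Ω φ x) := by
  have h1 := hR.cos_pos hS hx
  have h2 := hR.κ_nonneg (target Ω φ x)
  have h3 := Ω.kurv_pos (target Ω φ x)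
  unfold bend
  positivity

/-- The mirror equation. Differentiating the stationarity condition gives the speed `d` of the
target point. Inserting it into the derivative of the transmitted direction leaves the front
curvature `S / (1 + ρ S)`, where `S` is the curvature just after reflection. -/
theorem second_transPhase (hR : Ray Ω n φ e κ) (hS : Sep Ω Λ n c) (s : ℝ) :
    iteratedDeriv 2 (fun s => transPhase Ω Λ φ (Λ.pt s)) s =
      nextCurv Ω φ κ (Λ.γ s) * inner ℝ (nextDir Ω φ (Λ.γ s)) (Λ.nrm s) ^ 2 -
        Λ.curv s * inner ℝ (nextDir Ω φ (Λ.γ s)) (Λ.nrm s) := by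
  have hx := Λ.γ_mem_body s
  obtain ⟨f, hf, hft, hfG⟩ := hR.exists_local_target hS s
  have hf' : HasDerivAt f (deriv f s) s := (hf.differentiableAt (by simp)).hasDerivAt
  have hy : target Ω φ (Λ.γ s) = Ω.pt (f s) := hft.self_of_nhds
  have hne := hS.ne _ hx _ (Ω.γ_mem_body (f s))
  have hρ : 0 < ‖Λ.γ s - Ω.γ (f s)‖ := norm_pos_iff.mpr (sub_ne_zero.mpr hne)
  have hF : HasDerivAt (fun s => Λ.γ s - Ω.γ (f s))
      (deriv Λ.γ s - deriv f s • deriv Ω.γ (f s)) s :=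
    (Λ.hasDerivAt_γ s).sub ((Ω.hasDerivAt_γ (f s)).scomp s hf')
  have hG : HasDerivAt (fun s => deriv Ω.γ (f s)) (deriv f s • iteratedDeriv 2 Ω.γ (f s)) s :=
    (Ω.hasDerivAt_deriv_γ (f s)).scomp s hf'
  have hψ : HasDerivAt (fun s => deriv (fun t => φ (Ω.pt t)) (f s))
      (iteratedDeriv 2 (fun t => φ (Ω.pt t)) (f s) * deriv f s) s :=
    (hR.hasDerivAt_deriv_phase (f s)).comp s hf'
  -- the derivative of the stationarity condition
  have h1 := (hψ.sub (hasDerivAt_inner_div_norm hF hG (sub_ne_zero.mpr hne))).unique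
    ((hasDerivAt_const s (0 : ℝ)).congr_of_eventuallyEq hfG)
  -- the derivative of the transmitted direction
  have h2 := hasDerivAt_inner_div_norm hF (Λ.hasDerivAt_deriv_γ s) (sub_ne_zero.mpr hne)
  have h3 : deriv (fun s => transPhase Ω Λ φ (Λ.pt s)) =ᶠ[𝓝 s]
      fun s => inner ℝ (Λ.γ s - Ω.γ (f s)) (deriv Λ.γ s) / ‖Λ.γ s - Ω.γ (f s)‖ := by
    filter_upwards [hft] with r hr
    rw [hR.deriv_transPhase hS, nextDir, hr, inner_dirn]
    rfl
  rw [iteratedDeriv_two_eq, (h2.congr_of_eventuallyEq h3).deriv]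
  have hcos := hR.cos_pos hS hx
  have hsec := (hR.one_add_pos hS hx)
  obtain ⟨-, he, -⟩ := (hR.isTarget_iff hS hx _).mp (hR.isTarget_target (Λ.γ s))
  have hp := sq_inner_rot (Ω := Λ) (Λ.γ s - Ω.γ (f s)) s
  have hq := sq_inner_rot (Ω := Ω) (Λ.γ s - Ω.γ (f s)) (f s)
  have hpt : ((Ω.pt (f s) : Plane)) = Ω.γ (f s) := rfl
  rw [nextCurv, nextDir, hy]
  rw [hy] at hcos hsec he
  rw [hR.second] at h1
  unfold bend at hsec ⊢
  rw [Ω.normal_pt, hpt] at hcos hsec he ⊢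
  rw [Ω.kurv_pt] at hsec ⊢
  rw [he, inner_sub_right, inner_smul_right, inner_smul_right, Ω.inner_iteratedDeriv_γ] at h1
  rw [inner_sub_right, inner_smul_right, Λ.inner_iteratedDeriv_γ]
  rw [← norm_mul_dirn _ _ (Ω.nrm (f s))] at h1 hq
  rw [← norm_mul_dirn _ _ (Λ.nrm s)] at hp ⊢
  generalize inner ℝ (rot (Λ.γ s - Ω.γ (f s))) (deriv Λ.γ s) = p at *
  generalize inner ℝ (rot (Λ.γ s - Ω.γ (f s))) (deriv Ω.γ (f s)) = q at *
  generalize inner ℝ (dirn (Λ.γ s) (Ω.γ (f s))) (Ω.nrm (f s)) = v at *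
  generalize inner ℝ (dirn (Λ.γ s) (Ω.γ (f s))) (Λ.nrm s) = w at *
  generalize ‖Λ.γ s - Ω.γ (f s)‖ = ρ at *
  generalize κ (Ω.pt (f s)) = k at *
  generalize Ω.curv (f s) = K at *
  generalize deriv f s = d at *
  set S := k + 2 * K / v with hSdef
  have hKv : k * v ^ 2 + 2 * K * v = v ^ 2 * S := by rw [hSdef]; field_simp
  have h4 : d * (v ^ 2 * (1 + ρ * S)) * ρ ^ 2 = p * q := by
    field_simp at h1
    have h5 : (1 + ρ * S) * v ^ 2 = v ^ 2 + ρ * (k * v ^ 2 + 2 * K * v) := by rw [hKv]; ring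
    have h6 : ρ ^ 2 * v ^ 2 = q ^ 2 := by rw [hq]; ring
    have : d * ((1 + ρ * S) * v ^ 2) * ρ ^ 2 = p * q := by
      rw [h5]
      linear_combination h1 + d * h6
    linear_combination this
  have h7 : 0 < 1 + ρ * S := by positivity
  -- Here `p` and `d * q` are `ρ` times the velocities of `x` and of its target transverse to the
  -- ray. The front widens by `1 + ρ S` between them, so only the stated fraction of `p` turns the
  -- ray.
  have h8 : p - d * q = p * (ρ * S / (1 + ρ * S)) := by
    have h9 : d * q * (1 + ρ * S) = p := by
      have : (d * q * (1 + ρ * S)) * q ^ 2 = p * q ^ 2 := by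
        rw [show q ^ 2 = ρ ^ 2 * v ^ 2 by rw [hq]; ring]
        have := congrArg (· * q) h4
        rw [mul_assoc p q q, ← sq, show q ^ 2 = ρ ^ 2 * v ^ 2 by rw [hq]; ring] at this
        linear_combination this
      refine mul_right_cancel₀ (b := q ^ 2) ?_ this
      rw [hq]; positivity
    field_simp
    linear_combination -h9
  rw [h8, show p * (ρ * S / (1 + ρ * S)) * p = p ^ 2 * (ρ * S / (1 + ρ * S)) by ring, hp]
  field_simp
  ring

/-- The transmitted phase again comes from a smooth field of rays. -/
theorem next (hR : Ray Ω n φ e κ) (hS : Sep Ω Λ n c) :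
    Ray Λ (-n) (transPhase Ω Λ φ) (fun x => nextDir Ω φ x) (fun x => nextCurv Ω φ κ x) where
  smooth := hR.contDiff_transPhase hS
  norm_e x := norm_dirn (hS.ne _ (Λ.mem_body x) _ (Ω.mem_body _))
  subgrad := hR.transPhase_subgrad hS
  inner_n x := by
    rw [inner_neg_right, neg_nonpos]
    exact hS.pos.le.trans (hS.le_inner_dirn (Λ.mem_body x) (Ω.mem_body _))
  κ_nonneg x := by
    have h1 := hR.one_add_pos hS (Λ.mem_body x)
    unfold nextCurv
    positivity
  second s := hR.second_transPhase hS s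

end Ray

/-! ### The amplitude factor of one transmission. -/

variable {Ω Λ : Obstacle} {n : Plane} {c : ℝ} {φ : Ω.Boundary → ℝ} {e : Ω.Boundary → Plane}
  {κ : Ω.Boundary → ℝ}

/-- The cosine of the angle of incidence of the direction `e` at `x`, or `0` in the shadow. -/
def lit (Ω : Obstacle) (e : Ω.Boundary → Plane) (x : Ω.Boundary) : ℝ :=
  max (-inner ℝ (e x) (Ω.normal x)) 0

/-- The factor by which the amplitude at the target point is multiplied. -/
def ampFactor (Ω Λ : Obstacle) (φ : Ω.Boundary → ℝ) (x : Λ.Boundary) : ℝ :=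
  1 / √‖(x : Plane) - target Ω φ x‖ * min (inner ℝ (nextDir Ω φ x) (Λ.normal x)) 0 *
    secondDeriv Ω φ x (target Ω φ x) ^ (-(1 / 2) : ℝ)

/-- The factor by which the reflected wave front widens on the way from the target point to `x`. -/
def stretch (Ω : Obstacle) (φ : Ω.Boundary → ℝ) (κ : Ω.Boundary → ℝ) (x : Plane) : ℝ :=
  1 + ‖x - target Ω φ x‖ * (κ (target Ω φ x) + bend Ω x (target Ω φ x))

theorem dirn_neg (x y : Plane) : dirn y x = -dirn x y := by
  rw [dirn, dirn, norm_sub_rev, ← smul_neg, neg_sub]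

namespace Ray

theorem lit_target (hR : Ray Ω n φ e κ) (hS : Sep Ω Λ n c) {x : Plane} (hx : x ∈ Λ.body) :
    lit Ω e (target Ω φ x) = inner ℝ (nextDir Ω φ x) (Ω.normal (target Ω φ x)) := by
  have h1 := ((hR.isTarget_iff hS hx _).mp (hR.isTarget_target x)).2.1
  rw [lit, h1, neg_neg]
  exact max_eq_left (hR.cos_pos hS hx).le

theorem le_lit_target (hR : Ray Ω n φ e κ) (hS : Sep Ω Λ n c) {x : Plane} (hx : x ∈ Λ.body) :
    c ≤ 2 * lit Ω e (target Ω φ x) := by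
  rw [hR.lit_target hS hx]
  exact ((hR.isTarget_iff hS hx _).mp (hR.isTarget_target x)).2.2

theorem lit_le_one (hR : Ray Ω n φ e κ) (x : Ω.Boundary) : lit Ω e x ≤ 1 := by
  refine max_le ?_ zero_le_one
  have := neg_le_of_abs_le (abs_real_inner_le_norm (e x) (Ω.normal x))
  rw [hR.norm_e, Ω.norm_normal] at this
  linarith

/-- The shadow is exactly where the arriving ray has positive product with the exterior normal at
`x`. The cut-off is therefore `min · 0`, and the amplitude stays continuous across the shadow
boundary. -/
theorem transAmp_eq (hS : Sep Ω Λ n c) (A : Ω.Boundary → ℂ) (x : Λ.Boundary) :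
    transAmp Ω Λ φ A x = A (target Ω φ x) * (ampFactor Ω Λ φ x : ℂ) := by
  have hyΛ : (target Ω φ x : Plane) ∉ Λ.body := fun h => hS.ne _ h _ (Ω.mem_body _) rfl
  have hiff := Λ.segment_inter_frontier_iff' hyΛ x
  rw [segment_symm, dirn_neg, inner_neg_left, neg_nonneg] at hiff
  rw [← nextDir] at hiff
  rw [transAmp, ampFactor, kernelF, ← inner_dirn, ← nextDir]
  split_ifs with h
  · rw [min_eq_left (hiff.mp h)]
  · rw [min_eq_right (not_le.mp fun h' => h (hiff.mpr h')).le]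
    simp

theorem stretch_pos (hR : Ray Ω n φ e κ) (hS : Sep Ω Λ n c) {x : Plane} (hx : x ∈ Λ.body) :
    0 < stretch Ω φ κ x := by
  have h1 := hR.one_add_pos hS hx
  unfold stretch
  positivity

/-- By `secondDeriv_eq`, distance times second derivative is the squared cosine at the target times
`stretch`. In this form the cosines cancel from one step to the next. -/
theorem abs_ampFactor (hR : Ray Ω n φ e κ) (hS : Sep Ω Λ n c) (x : Λ.Boundary) :
    |ampFactor Ω Λ φ x| = lit Λ (fun x => nextDir Ω φ x) x /
      (lit Ω e (target Ω φ x) * √(stretch Ω φ κ x)) := by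
  have hx := Λ.mem_body x
  have hv : 0 < inner ℝ (nextDir Ω φ x) (Ω.normal (target Ω φ x)) := hR.cos_pos hS hx
  have hρ : 0 < ‖(x : Plane) - target Ω φ x‖ :=
    norm_pos_iff.mpr (sub_ne_zero.mpr (hS.ne _ hx _ (Ω.mem_body _)))
  have hD := hR.secondDeriv_pos hS hx (hR.isTarget_target x)
  have hs := hR.stretch_pos hS hx
  have h1 : ‖(x : Plane) - target Ω φ x‖ * secondDeriv Ω φ x (target Ω φ x) =
      inner ℝ (nextDir Ω φ x) (Ω.normal (target Ω φ x)) ^ 2 * stretch Ω φ κ x := by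
    rw [hR.secondDeriv_eq hS hx (hR.isTarget_target x), stretch, bend, nextDir]
    field_simp
    ring
  have h2 : √‖(x : Plane) - target Ω φ x‖ * √(secondDeriv Ω φ x (target Ω φ x)) =
      inner ℝ (nextDir Ω φ x) (Ω.normal (target Ω φ x)) * √(stretch Ω φ κ x) := by
    rw [← Real.sqrt_mul hρ.le, h1, Real.sqrt_mul (by positivity), Real.sqrt_sq hv.le]
  have h3 : |min (inner ℝ (nextDir Ω φ x) (Λ.normal x)) 0| =
      lit Λ (fun x => nextDir Ω φ x) x := by
    rw [abs_of_nonpos (min_le_right _ _), lit, ← max_neg_neg, neg_zero]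
  rw [ampFactor, abs_mul, abs_mul, h3, hR.lit_target hS hx, ← h2, Real.rpow_neg hD.le,
    ← Real.sqrt_eq_rpow, abs_of_pos (by positivity), abs_of_pos (by positivity)]
  have h4 := Real.sqrt_pos.mpr hρ
  have h5 := Real.sqrt_pos.mpr hD
  field_simp

theorem continuous_nextDir (hR : Ray Ω n φ e κ) (hS : Sep Ω Λ n c) :
    Continuous fun x : Λ.Boundary => nextDir Ω φ x := by
  have h1 := hR.continuous_target hS
  have h2 : Continuous fun x : Λ.Boundary => (x : Plane) - target Ω φ x :=
    continuous_subtype_val.sub (continuous_subtype_val.comp h1)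
  exact (h2.norm.inv₀ fun x => norm_ne_zero_iff.mpr
    (sub_ne_zero.mpr (hS.ne _ (Λ.mem_body x) _ (Ω.mem_body _)))).smul h2

theorem continuous_ampFactor (hR : Ray Ω n φ e κ) (hS : Sep Ω Λ n c) :
    Continuous (ampFactor Ω Λ φ) := by
  have h1 := hR.continuous_target hS
  have h2 : Continuous fun x : Λ.Boundary => ‖(x : Plane) - target Ω φ x‖ :=
    (continuous_subtype_val.sub (continuous_subtype_val.comp h1)).norm
  have h2' : ∀ x : Λ.Boundary, ‖(x : Plane) - target Ω φ x‖ ≠ 0 := fun x => norm_ne_zero_iff.mpr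
    (sub_ne_zero.mpr (hS.ne _ (Λ.mem_body x) _ (Ω.mem_body _)))
  have h3 := hR.continuous_nextDir hS
  have h4 : Continuous fun y : Ω.Boundary =>
      iteratedDeriv 2 (fun t => φ (Ω.pt t)) (Ω.param y) := by
    refine Ω.continuous_of_comp_pt ?_
    have hper : Function.Periodic (iteratedDeriv 2 fun t => φ (Ω.pt t)) Ω.L := by
      rw [iteratedDeriv_two_eq]
      exact periodic_deriv (periodic_deriv fun t => by simp only [Ω.periodic_pt t])
    simp only [Ω.apply_param_pt hper]
    exact (hR.smooth.of_le (by norm_cast)).continuous_iteratedDeriv 2 le_rfl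
  have h5 : Continuous fun x : Λ.Boundary => inner ℝ (nextDir Ω φ x) (Ω.normal (target Ω φ x)) :=
    h3.inner (Ω.continuous_normal.comp h1)
  have h6 : Continuous fun x : Λ.Boundary => secondDeriv Ω φ x (target Ω φ x) := by
    have : (fun x : Λ.Boundary => secondDeriv Ω φ x (target Ω φ x)) = fun x : Λ.Boundary =>
        iteratedDeriv 2 (fun t => φ (Ω.pt t)) (Ω.param (target Ω φ x)) +
          Ω.kurv (target Ω φ x) * inner ℝ (nextDir Ω φ x) (Ω.normal (target Ω φ x)) +
          inner ℝ (nextDir Ω φ x) (Ω.normal (target Ω φ x)) ^ 2 /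
            ‖(x : Plane) - target Ω φ x‖ := by
      funext x
      rw [secondDeriv, hR.iteratedDeriv_combinedPhase (hS.notMem (Λ.mem_body x)), Ω.γ_param]
      rfl
    rw [this]
    exact ((h4.comp h1).add ((Ω.continuous_kurv.comp h1).mul h5)).add ((h5.pow 2).div h2 h2')
  refine ((continuous_const.div h2.sqrt fun x => ?_).mul
    ((h3.inner Λ.continuous_normal).min continuous_const)).mul (h6.rpow_const fun x => Or.inl ?_)
  · exact (Real.sqrt_pos.mpr (lt_of_le_of_ne (norm_nonneg _) (h2' x).symm)).ne'
  · exact (hR.secondDeriv_pos hS (Λ.mem_body x) (hR.isTarget_target x)).ne'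

end Ray

/-- The rays of a plane wave. -/
theorem ray_plane (Ω : Obstacle) {α n : Plane} (hα : ‖α‖ = 1) (hn : inner ℝ α n = 0) :
    Ray Ω n (fun y => inner ℝ α (y : Plane)) (fun _ => α) fun _ => 0 where
  smooth := contDiff_const.inner ℝ Ω.contDiff_γ
  norm_e _ := hα
  subgrad y z := by rw [inner_sub_right]; linarith
  inner_n _ := hn.le
  κ_nonneg _ := le_rfl
  second t := by
    have h1 : deriv (fun t => inner ℝ α (Ω.pt t : Plane)) = fun t => inner ℝ α (deriv Ω.γ t) :=
      funext fun t => (Ω.hasDerivAt_inner_γ α t).deriv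
    rw [iteratedDeriv_two_eq, h1, (Ω.hasDerivAt_inner_deriv_γ α t).deriv, Ω.inner_iteratedDeriv_γ]
    ring

/-! ### Iteration -/

section Iteration

variable (Ω : Fin 2 → Obstacle) (α : Plane)

/-- The phases of the iterates. -/
def ph : ℕ → ∀ j, (Ω j).Boundary → ℝ
  | 0, _, y => inner ℝ α (y : Plane)
  | ℓ + 1, j, x => transPhase (Ω (1 - j)) (Ω j) (ph ℓ (1 - j)) x

/-- The target points of the iterates. -/
def tgt (ℓ : ℕ) (j : Fin 2) (x : (Ω j).Boundary) : (Ω (1 - j)).Boundary :=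
  target (Ω (1 - j)) (ph Ω α ℓ (1 - j)) x

/-- The incoming directions of the iterates. -/
def dir : ℕ → ∀ j, (Ω j).Boundary → Plane
  | 0, _, _ => α
  | ℓ + 1, j, x => nextDir (Ω (1 - j)) (ph Ω α ℓ (1 - j)) x

/-- The curvatures of the wave fronts of the iterates. -/
def crv : ℕ → ∀ j, (Ω j).Boundary → ℝ
  | 0, _, _ => 0
  | ℓ + 1, j, x => nextCurv (Ω (1 - j)) (ph Ω α ℓ (1 - j)) (crv ℓ (1 - j)) x

/-- The widths of the wave fronts of the iterates. -/
def wid : ℕ → ∀ j, (Ω j).Boundary → ℝ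
  | 0, _, _ => 1
  | ℓ + 1, j, x => wid ℓ (1 - j) (tgt Ω α ℓ j x) *
      stretch (Ω (1 - j)) (ph Ω α ℓ (1 - j)) (crv Ω α ℓ (1 - j)) x

/-- Two obstacles that are separated by a line in the direction of the wave. -/
structure Config (n : Fin 2 → Plane) (c : ℝ) : Prop where
  norm_α : ‖α‖ = 1
  inner_α : ∀ j, inner ℝ α (n j) = 0
  neg : ∀ j, -n (1 - j) = n j
  sep : ∀ j, Sep (Ω (1 - j)) (Ω j) (n (1 - j)) c

variable {Ω α}

theorem exists_sep {Ω Λ : Obstacle} {m : Plane} {b : ℝ} (hm0 : m ≠ 0)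
    (h0 : ∀ x ∈ Ω.body, inner ℝ x m < b) (h1 : ∀ x ∈ Λ.body, b < inner ℝ x m) :
    ∃ c, Sep Ω Λ (‖m‖⁻¹ • m) c := by
  have hm : 0 < ‖m‖ := norm_pos_iff.mpr hm0
  have hK := Λ.isCompact_body.prod Ω.isCompact_body
  have hne : (Λ.body ×ˢ Ω.body).Nonempty := ⟨(Λ.γ 0, Ω.γ 0), Λ.γ_mem_body 0, Ω.γ_mem_body 0⟩
  obtain ⟨p, hp, hpm⟩ := hK.exists_isMinOn hne (f := fun p : Plane × Plane =>
    inner ℝ (p.1 - p.2) m) (by fun_prop)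
  obtain ⟨q, hq, hqm⟩ := hK.exists_isMaxOn hne (f := fun p : Plane × Plane => ‖p.1 - p.2‖)
    (by fun_prop)
  have hlt : ∀ x ∈ Λ.body, ∀ y ∈ Ω.body, 0 < inner ℝ (x - y) m := fun x hx y hy => by
    rw [inner_sub_left]; linarith [h0 y hy, h1 x hx]
  have hpne : ∀ x ∈ Λ.body, ∀ y ∈ Ω.body, x ≠ y := fun x hx y hy hxy => by
    have := hlt x hx y hy
    rw [hxy, sub_self, inner_zero_left] at this
    exact lt_irrefl _ this
  have hp0 := hlt _ hp.1 _ hp.2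
  have hq0 : 0 < ‖q.1 - q.2‖ := norm_pos_iff.mpr (sub_ne_zero.mpr (hpne _ hq.1 _ hq.2))
  -- The constant is the smallest gap in the unit direction of `m` over the largest distance between
  -- the bodies.
  refine ⟨inner ℝ (p.1 - p.2) m / (‖m‖ * ‖q.1 - q.2‖),
    div_pos hp0 (mul_pos hm hq0), ?_, ?_, hpne⟩
  · rw [norm_smul, norm_inv, norm_norm, inv_mul_cancel₀ hm.ne']
  · intro x hx y hy
    have h2 : inner ℝ (p.1 - p.2) m ≤ inner ℝ (x - y) m :=
      isMinOn_iff.mp hpm (x, y) (mk_mem_prod hx hy)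
    have h3 : ‖x - y‖ ≤ ‖q.1 - q.2‖ := isMaxOn_iff.mp hqm (x, y) (mk_mem_prod hx hy)
    rw [inner_smul_right, div_mul_eq_mul_div, div_le_iff₀ (mul_pos hm hq0)]
    have : ‖m‖⁻¹ * inner ℝ (x - y) m * (‖m‖ * ‖q.1 - q.2‖) =
        inner ℝ (x - y) m * ‖q.1 - q.2‖ := by field_simp
    rw [this]
    exact mul_le_mul h2 h3 (norm_nonneg _) (hlt x hx y hy).le

theorem Sep.symm {Ω Λ : Obstacle} {n : Plane} {c : ℝ} (h : Sep Ω Λ n c) : Sep Λ Ω (-n) c where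
  pos := h.pos
  norm_n := by rw [norm_neg, h.norm_n]
  le x hx y hy := by
    have := h.le y hy x hx
    rwa [norm_sub_rev, ← neg_sub x y, inner_neg_left, ← inner_neg_right] at this
  ne x hx y hy h' := h.ne y hy x hx h'.symm

theorem NoOcclusion.exists_config (hα : ‖α‖ = 1) (h : NoOcclusion Ω α) :
    ∃ n c, Config Ω α n c := by
  obtain ⟨m, hm0, hαm, b, h0, h1⟩ := h
  obtain ⟨c, hc⟩ := exists_sep hm0 h0 h1
  have e1 : (1 : Fin 2) - 0 = 1 := rfl
  have e2 : (1 : Fin 2) - 1 = 0 := rfl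
  refine ⟨![‖m‖⁻¹ • m, -(‖m‖⁻¹ • m)], c, hα, ?_, ?_, ?_⟩
  · rw [Fin.forall_fin_two]
    simp [inner_smul_right, hαm]
  · rw [Fin.forall_fin_two]
    simp [e1]
  · rw [Fin.forall_fin_two, e1, e2]
    exact ⟨hc.symm, hc⟩

variable {n : Fin 2 → Plane} {c : ℝ}

namespace Config

/-- The direction condition survives because a ray that has just arrived at `Ω j` moves against `n
j`, the direction towards the other obstacle. -/
theorem ray (hc : Config Ω α n c) (ℓ : ℕ) (j : Fin 2) :
    Ray (Ω j) (n j) (ph Ω α ℓ j) (dir Ω α ℓ j) (crv Ω α ℓ j) := by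
  induction ℓ generalizing j with
  | zero => exact ray_plane (Ω j) hc.norm_α (hc.inner_α j)
  | succ ℓ ih =>
    have := (ih (1 - j)).next (hc.sep j)
    rw [hc.neg j] at this
    exact this

theorem wid_pos (hc : Config Ω α n c) (ℓ : ℕ) (j : Fin 2) (x : (Ω j).Boundary) :
    0 < wid Ω α ℓ j x := by
  induction ℓ generalizing j with
  | zero => exact one_pos
  | succ ℓ ih =>
    exact mul_pos (ih _ _) ((hc.ray ℓ (1 - j)).stretch_pos (hc.sep j) ((Ω j).mem_body x))

end Config

theorem phase_kirchhoffWave (k : ℝ) (ℓ : ℕ) (h : TotalBoundary Ω → ℂ) :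
    (kirchhoffWave Ω α k ℓ h).phase = ph Ω α ℓ := by
  induction ℓ with
  | zero => rfl
  | succ ℓ ih =>
    rw [kirchhoffWave, Function.iterate_succ_apply']
    funext j x
    change transPhase (Ω (1 - j)) (Ω j) ((kirchhoffWave Ω α k ℓ h).phase (1 - j)) x = _
    rw [ih]
    rfl

theorem amp_zero (k : ℝ) (h : TotalBoundary Ω → ℂ) (j : Fin 2) (x : (Ω j).Boundary) :
    (kirchhoffWave Ω α k 0 h).amp j x =
      Complex.exp (-(Complex.I * k * (inner ℝ α (x : Plane) : ℝ))) * h ⟨j, x⟩ := rfl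

theorem Config.amp_succ (hc : Config Ω α n c) (k : ℝ) (ℓ : ℕ) (h : TotalBoundary Ω → ℂ) (j : Fin 2)
    (x : (Ω j).Boundary) :
    (kirchhoffWave Ω α k (ℓ + 1) h).amp j x =
      (kirchhoffWave Ω α k ℓ h).amp (1 - j) (tgt Ω α ℓ j x) *
        (ampFactor (Ω (1 - j)) (Ω j) (ph Ω α ℓ (1 - j)) x : ℂ) := by
  rw [kirchhoffWave, Function.iterate_succ_apply']
  change transAmp (Ω (1 - j)) (Ω j) ((kirchhoffWave Ω α k ℓ h).phase (1 - j))
    ((kirchhoffWave Ω α k ℓ h).amp (1 - j)) x = _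
  rw [phase_kirchhoffWave, Ray.transAmp_eq (hc.sep j)]
  rfl

theorem norm_exp_I_mul (a b : ℝ) : ‖Complex.exp (Complex.I * a * b)‖ = 1 := by
  rw [mul_assoc, mul_comm, ← Complex.ofReal_mul, Complex.norm_exp_ofReal_mul_I]

theorem norm_amp_zero (k : ℝ) (h : TotalBoundary Ω → ℂ) (j : Fin 2) (x : (Ω j).Boundary) :
    ‖(kirchhoffWave Ω α k 0 h).amp j x‖ = ‖h ⟨j, x⟩‖ := by
  rw [amp_zero, norm_mul, Complex.exp_neg, norm_inv, norm_exp_I_mul, inv_one, one_mul]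

theorem norm_kirchhoffPow (k : ℝ) (ℓ : ℕ) (h : TotalBoundary Ω → ℂ) (x : TotalBoundary Ω) :
    ‖kirchhoffPow Ω α k ℓ h x‖ = ‖(kirchhoffWave Ω α k ℓ h).amp x.1 x.2‖ := by
  rw [kirchhoffPow, Wave.toFun, norm_mul, norm_exp_I_mul, one_mul]

theorem Config.norm_amp_succ (hc : Config Ω α n c) (k : ℝ) (ℓ : ℕ) (h : TotalBoundary Ω → ℂ)
    (j : Fin 2) (x : (Ω j).Boundary) :
    ‖(kirchhoffWave Ω α k (ℓ + 1) h).amp j x‖ =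
      ‖(kirchhoffWave Ω α k ℓ h).amp (1 - j) (tgt Ω α ℓ j x)‖ *
        (lit (Ω j) (dir Ω α (ℓ + 1) j) x / (lit (Ω (1 - j)) (dir Ω α ℓ (1 - j)) (tgt Ω α ℓ j x) *
          √(stretch (Ω (1 - j)) (ph Ω α ℓ (1 - j)) (crv Ω α ℓ (1 - j)) x))) := by
  rw [hc.amp_succ, norm_mul, Complex.norm_real, Real.norm_eq_abs,
    (hc.ray ℓ (1 - j)).abs_ampFactor (hc.sep j)]
  rfl

theorem Config.lit_tgt_pos (hc : Config Ω α n c) (ℓ : ℕ) (j : Fin 2) (x : (Ω j).Boundary) :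
    0 < lit (Ω (1 - j)) (dir Ω α ℓ (1 - j)) (tgt Ω α ℓ j x) := by
  have := (hc.ray ℓ (1 - j)).le_lit_target (hc.sep j) ((Ω j).mem_body x)
  have h2 := (hc.sep j).pos
  unfold tgt
  linarith

/-- The amplitude at `x` is the original amplitude at the starting point `z` of the ray through `x`,
times the angle factors at the two ends, over the square root of the width of the wave front. -/
theorem Config.norm_amp_eq (hc : Config Ω α n c) (ℓ : ℕ) (j : Fin 2) (x : (Ω j).Boundary) :
    ∃ z : TotalBoundary Ω, c ≤ 2 * lit (Ω z.1) (fun _ => α) z.2 ∧ ∀ (k : ℝ) h,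
      ‖(kirchhoffWave Ω α k (ℓ + 1) h).amp j x‖ = lit (Ω j) (dir Ω α (ℓ + 1) j) x * ‖h z‖ /
        (lit (Ω z.1) (fun _ => α) z.2 * √(wid Ω α (ℓ + 1) j x)) := by
  induction ℓ generalizing j with
  | zero =>
    refine ⟨⟨1 - j, tgt Ω α 0 j x⟩, ?_, fun k h => ?_⟩
    · exact (hc.ray 0 (1 - j)).le_lit_target (hc.sep j) ((Ω j).mem_body x)
    · rw [hc.norm_amp_succ, norm_amp_zero, wid, wid, one_mul, mul_div_assoc', mul_comm ‖h _‖]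
      rfl
  | succ ℓ ih =>
    obtain ⟨z, hz, hzh⟩ := ih (1 - j) (tgt Ω α (ℓ + 1) j x)
    refine ⟨z, hz, fun k h => ?_⟩
    have h1 := hc.lit_tgt_pos (ℓ + 1) j x
    have h2 := hc.wid_pos (ℓ + 1) (1 - j) (tgt Ω α (ℓ + 1) j x)
    have h3 := (hc.ray (ℓ + 1) (1 - j)).stretch_pos (hc.sep j) ((Ω j).mem_body x)
    have h4 := (hc.sep j).pos
    have h5 : 0 < lit (Ω z.1) (fun _ => α) z.2 := by linarith
    rw [hc.norm_amp_succ, hzh, wid.eq_def Ω α (ℓ + 1 + 1)]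
    simp only
    rw [Real.sqrt_mul h2.le]
    have h6 := Real.sqrt_pos.mpr h2
    have h7 := Real.sqrt_pos.mpr h3
    field_simp

theorem Config.continuous_amp (hc : Config Ω α n c) (k : ℝ) (ℓ : ℕ) {h : TotalBoundary Ω → ℂ}
    (hh : Continuous h) (j : Fin 2) : Continuous ((kirchhoffWave Ω α k ℓ h).amp j) := by
  induction ℓ generalizing j with
  | zero =>
    have h1 : Continuous fun x : (Ω j).Boundary => h ⟨j, x⟩ := hh.comp continuous_sigmaMk
    change Continuous fun x : (Ω j).Boundary =>
      Complex.exp (-(Complex.I * k * (inner ℝ α (x : Plane) : ℝ))) * h ⟨j, x⟩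
    have h2 : Continuous fun x : (Ω j).Boundary => ((inner ℝ α (x : Plane) : ℝ) : ℂ) :=
      Complex.continuous_ofReal.comp (continuous_const.inner continuous_subtype_val)
    exact (Complex.continuous_exp.comp (continuous_const.mul h2).neg).mul h1
  | succ ℓ ih =>
    rw [show (kirchhoffWave Ω α k (ℓ + 1) h).amp j = _ from funext fun x => hc.amp_succ k ℓ h j x]
    exact ((ih (1 - j)).comp ((hc.ray ℓ (1 - j)).continuous_target (hc.sep j))).mul
      (Complex.continuous_ofReal.comp ((hc.ray ℓ (1 - j)).continuous_ampFactor (hc.sep j)))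

theorem Config.amp_add (hc : Config Ω α n c) (k : ℝ) (ℓ : ℕ) (h g : TotalBoundary Ω → ℂ) (j : Fin 2)
    (x : (Ω j).Boundary) : (kirchhoffWave Ω α k ℓ (h + g)).amp j x =
      (kirchhoffWave Ω α k ℓ h).amp j x + (kirchhoffWave Ω α k ℓ g).amp j x := by
  induction ℓ generalizing j with
  | zero => rw [amp_zero, amp_zero, amp_zero, Pi.add_apply, mul_add]
  | succ ℓ ih => rw [hc.amp_succ, hc.amp_succ, hc.amp_succ, ih, add_mul]

theorem Config.amp_smul (hc : Config Ω α n c) (k : ℝ) (ℓ : ℕ) (a : ℂ) (h : TotalBoundary Ω → ℂ)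
    (j : Fin 2) (x : (Ω j).Boundary) : (kirchhoffWave Ω α k ℓ (a • h)).amp j x =
      a * (kirchhoffWave Ω α k ℓ h).amp j x := by
  induction ℓ generalizing j with
  | zero => rw [amp_zero, amp_zero, Pi.smul_apply, smul_eq_mul, mul_left_comm]
  | succ ℓ ih => rw [hc.amp_succ, hc.amp_succ, ih, mul_assoc]

theorem Config.continuous_ph (hc : Config Ω α n c) (ℓ : ℕ) (j : Fin 2) :
    Continuous (ph Ω α ℓ j) := (hc.ray ℓ j).continuous_phase

theorem Config.continuous_kirchhoffPow (hc : Config Ω α n c) (k : ℝ) (ℓ : ℕ)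
    {h : TotalBoundary Ω → ℂ} (hh : Continuous h) : Continuous (kirchhoffPow Ω α k ℓ h) := by
  refine continuous_sigma fun j => ?_
  have h1 := hc.continuous_amp k ℓ hh j
  have h2 := hc.continuous_ph ℓ j
  change Continuous fun x : (Ω j).Boundary => Complex.exp (Complex.I * k *
    (kirchhoffWave Ω α k ℓ h).phase j x) * (kirchhoffWave Ω α k ℓ h).amp j x
  rw [phase_kirchhoffWave]
  fun_prop

end Iteration

/-! ### Closest points -/

section Closest

variable {Ω Λ : Obstacle}

theorem dirn_eq_normal_of_min {x : Plane} (hx : x ∉ Ω.body) {y : Ω.Boundary}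
    (h : ∀ z : Ω.Boundary, ‖x - y‖ ≤ ‖x - z‖) : dirn x y = Ω.normal y := by
  have hne : x ≠ y := fun h' => hx (h' ▸ Ω.mem_body y)
  have h1 : 0 ≤ inner ℝ (dirn x y) (Ω.normal y) := by
    rw [← Ω.segment_inter_frontier_iff' hx]
    refine Subset.antisymm ?_ (singleton_subset_iff.mpr ⟨right_mem_segment ℝ _ _, y.2⟩)
    rintro w ⟨hw, hwf⟩
    have h2 := h ⟨w, hwf⟩
    have h3 := dist_add_dist_of_mem_segment hw
    rw [dist_eq_norm, dist_eq_norm, dist_eq_norm] at h3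
    have h4 : ‖w - y‖ = 0 := le_antisymm (by linarith) (norm_nonneg _)
    exact sub_eq_zero.mp (norm_eq_zero.mp h4)
  have hγ : x ≠ Ω.γ (Ω.param y) := by rwa [Ω.γ_param]
  have h2 := IsLocalMin.hasDerivAt_eq_zero (Filter.Eventually.of_forall fun t => ?_)
    (hasDerivAt_norm ((Ω.hasDerivAt_γ (Ω.param y)).const_sub x) (sub_ne_zero.mpr hγ))
  · rw [Ω.γ_param, inner_neg_right, neg_div, ← inner_dirn, neg_eq_zero] at h2
    have h3 := Ω.eq_smul_nrm h2
    have h4 : Ω.nrm (Ω.param y) = Ω.normal y := rfl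
    rw [h4] at h3
    have h5 := congrArg norm h3
    rw [norm_dirn hne, norm_smul, Ω.norm_normal, mul_one, Real.norm_of_nonneg h1] at h5
    rw [h3, ← h5, one_smul]
  · change ‖x - Ω.γ (Ω.param y)‖ ≤ ‖x - Ω.γ t‖
    rw [Ω.γ_param]
    exact h (Ω.pt t)

/-- The closest pair of points is unique. -/
theorem closest_unique (hdis : ∀ x ∈ Λ.body, x ∉ Ω.body) {x p : Λ.Boundary} {y q : Ω.Boundary}
    (hpq : ∀ (x : Λ.Boundary) (y : Ω.Boundary), ‖(p : Plane) - q‖ ≤ ‖(x : Plane) - y‖)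
    (hxy : ‖(x : Plane) - y‖ ≤ ‖(p : Plane) - q‖) : y = q := by
  by_contra hne
  -- A shortest segment is normal to both curves. If `q ≠ y`, strict convexity makes the projection
  -- of `p - q` onto its direction longer than the segment itself.
  have hu : dirn x y = Ω.normal y :=
    dirn_eq_normal_of_min (hdis _ (Λ.mem_body x)) fun z => hxy.trans (hpq x z)
  have hu' : dirn y x = Λ.normal x :=
    dirn_eq_normal_of_min (fun h => hdis _ h (Ω.mem_body y)) fun z => by
      rw [norm_sub_rev, norm_sub_rev (y : Plane)]; exact hxy.trans (hpq z y)
  have h1 : inner ℝ ((q : Plane) - y) (dirn x y) < 0 := by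
    rw [hu]; exact Ω.inner_sub_normal_neg (Ω.mem_body q) fun h => hne (Subtype.ext h.symm)
  have h2 : inner ℝ ((p : Plane) - x) (dirn y x) ≤ 0 := by
    rw [hu']
    rcases eq_or_ne p x with rfl | h
    · simp
    · exact (Λ.inner_sub_normal_neg (Λ.mem_body p) fun h' => h (Subtype.ext h')).le
  rw [dirn_neg, inner_neg_right] at h2
  have h3 := inner_dirn_self (x : Plane) (y : Plane)
  have hxyne : (x : Plane) ≠ y := fun h => hdis _ (Λ.mem_body x) (by rw [h]; exact Ω.mem_body y)
  have h4 := real_inner_le_norm ((p : Plane) - q) (dirn x y)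
  have h5 : (p : Plane) - q = (p - x) + (x - y) - (q - y) := by abel
  have h6 : inner ℝ ((p : Plane) - q) (dirn x y) = inner ℝ ((p : Plane) - x) (dirn x y) +
      ‖(x : Plane) - y‖ - inner ℝ ((q : Plane) - y) (dirn x y) := by
    rw [h5, inner_sub_left, inner_add_left, ← h3, real_inner_comm (dirn (x : Plane) y) (x - y)]
  rw [norm_dirn hxyne, mul_one, h6] at h4
  linarith [hpq x y]

end Closest

/-! ### A linear model of the growth of wave fronts -/

/-- The front curvatures of the periodic ray between the closest points: a cycle of length two of
the mirror equation. The composition of the two mirror maps preserves `[0, 1/d]`, so it has a fixed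
point. -/
theorem exists_model_fixed {d b b' : ℝ} (hd : 0 < d) (hb : 0 < b) (hb' : 0 < b') :
    ∃ σ σ' : ℝ, 0 < σ ∧ 0 < σ' ∧ σ' * (1 + d * (σ + b)) = σ + b ∧
      σ * (1 + d * (σ' + b')) = σ' + b' := by
  set F : ℝ → ℝ → ℝ := fun b κ => (κ + b) / (1 + d * (κ + b)) with hF
  have hmaps : ∀ b > 0, MapsTo (F b) (Icc 0 d⁻¹) (Icc 0 d⁻¹) := fun b hb κ hκ => by
    have h1 : 0 < κ + b := by linarith [hκ.1]
    refine ⟨by positivity, ?_⟩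
    rw [hF]
    simp only
    rw [div_le_iff₀ (by positivity)]
    field_simp
    linarith
  have hcont : ∀ b > 0, ContinuousOn (F b) (Icc 0 d⁻¹) := fun b hb => by
    refine ContinuousOn.div (by fun_prop) (by fun_prop) fun κ hκ => ?_
    have h1 : 0 < κ + b := by linarith [hκ.1]
    positivity
  obtain ⟨σ, hσ, hfix⟩ := exists_mem_Icc_isFixedPt_of_mapsTo
    (((hcont b' hb').comp (hcont b hb) (hmaps b hb))) (by positivity)
    ((hmaps b' hb').comp (hmaps b hb))
  have h0 := hσ.1
  have h1 : 0 < F b σ := by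
    have : 0 < σ + b := by linarith
    simp only [hF]; positivity
  have h2 : F b' (F b σ) = σ := hfix
  have h3 : 0 < σ := by
    rw [← h2]
    generalize F b σ = s at h1
    simp only [hF]; positivity
  refine ⟨σ, F b σ, h3, h1, ?_, ?_⟩
  · simp only [hF]; field_simp
  · generalize F b σ = s at h1 h2
    rw [← h2]
    simp only [hF]; field_simp

/-- A positive eigenvector of the alternating linear model. -/
theorem exists_model {d : ℝ} {b : Fin 2 → ℝ} (hd : 0 < d) (hb : ∀ j, 0 < b j) :
    ∃ (μ : ℝ) (a g : Fin 2 → ℝ), 0 < μ ∧ (∀ j, 0 < a j) ∧ (∀ j, 0 < g j) ∧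
      (∀ j, (1 + d * b (1 - j)) * a (1 - j) + d * g (1 - j) = μ * a j) ∧
      ∀ j, b (1 - j) * a (1 - j) + g (1 - j) = μ * g j := by
  obtain ⟨σ, σ', h1, h2, h3, h4⟩ := exists_model_fixed hd (hb 0) (hb 1)
  have hb0 := hb 0
  have hb1 := hb 1
  set l := 1 + d * (σ + b 0) with hl
  set l' := 1 + d * (σ' + b 1) with hl'
  have hl0 : 0 < l := by positivity
  have hl0' : 0 < l' := by positivity
  have hs := Real.mul_self_sqrt hl0.le
  have hs' := Real.mul_self_sqrt hl0'.le
  have hp := Real.sqrt_pos.mpr hl0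
  have hp' := Real.sqrt_pos.mpr hl0'
  have e1 : (1 : Fin 2) - 0 = 1 := rfl
  have e2 : (1 : Fin 2) - 1 = 0 := rfl
  -- The front widens alternately by `l` and `l'`. The weights `√l'` and `√l` even this out to the
  -- factor `√l * √l'` at each step, and `g` is `a` times the periodic curvature.
  refine ⟨√l * √l', ![√l', √l], ![√l' * σ, √l * σ'], by positivity, ?_, ?_, ?_, ?_⟩ <;>
    rw [Fin.forall_fin_two]
  · exact ⟨hp', hp⟩
  · exact ⟨mul_pos hp' h1, mul_pos hp h2⟩
  · simp only [e1, e2, Matrix.cons_val_zero, Matrix.cons_val_one]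
    constructor
    · linear_combination √l * (-hs' + hl')
    · linear_combination √l' * (-hs + hl)
  · simp only [e1, e2, Matrix.cons_val_zero, Matrix.cons_val_one]
    constructor
    · linear_combination -√l * (h4 + σ * hs')
    · linear_combination -√l' * (h3 + σ' * hs)

/-- Only the compact set where `f ≥ ε` matters; `g` has a positive minimum there. -/
theorem exists_le_add_mul {X : Type*} [TopologicalSpace X] [CompactSpace X] {K : Set X}
    (hK : IsClosed K) {f g : X → ℝ} (hf : ContinuousOn f K) (hg : ContinuousOn g K)
    (hg0 : ∀ x ∈ K, 0 ≤ g x) (hfg : ∀ x ∈ K, g x = 0 → f x ≤ 0) {ε : ℝ} (hε : 0 < ε) :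
    ∃ C, 0 ≤ C ∧ ∀ x ∈ K, f x ≤ ε + C * g x := by
  have hK' : IsCompact (K ∩ f ⁻¹' Ici ε) :=
    (hf.preimage_isClosed_of_isClosed hK isClosed_Ici).isCompact
  rcases (K ∩ f ⁻¹' Ici ε).eq_empty_or_nonempty with he | hne
  · refine ⟨0, le_rfl, fun x hx => ?_⟩
    by_contra! h
    have : x ∈ K ∩ f ⁻¹' Ici ε := ⟨hx, by simp only [mem_preimage, mem_Ici]; linarith⟩
    rw [he] at this
    exact this
  · obtain ⟨p, hp, hpm⟩ := hK'.exists_isMinOn hne (hg.mono inter_subset_left)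
    obtain ⟨q, hq, hqm⟩ := hK'.exists_isMaxOn hne (hf.mono inter_subset_left)
    have hgp : 0 < g p := by
      refine lt_of_le_of_ne (hg0 p hp.1) fun h => ?_
      have h1 := hfg p hp.1 h.symm
      have h2 : ε ≤ f p := hp.2
      linarith
    have hfq : ε ≤ f q := hq.2
    have hC : 0 ≤ f q / g p := div_nonneg (by linarith) hgp.le
    refine ⟨f q / g p, hC, fun x hx => ?_⟩
    by_cases h : ε ≤ f x
    · have h1 : g p ≤ g x := isMinOn_iff.mp hpm x ⟨hx, h⟩
      have h2 : f x ≤ f q := isMaxOn_iff.mp hqm x ⟨hx, h⟩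
      have h3 : f q / g p * g p = f q := div_mul_cancel₀ _ hgp.ne'
      have h4 := mul_le_mul_of_nonneg_left h1 hC
      linarith
    · have := mul_nonneg hC (hg0 x hx)
      linarith

/-! ### Growth of wave fronts -/

section Growth

variable {Ω : Fin 2 → Obstacle} {α : Plane} {n : Fin 2 → Plane} {c : ℝ}

/-- A pair of boundary points at minimal distance `d`. -/
structure Closest (Ω : Fin 2 → Obstacle) (p : ∀ j, (Ω j).Boundary) (d : ℝ) : Prop where
  pos : 0 < d
  eq : ∀ j, ‖(p j : Plane) - p (1 - j)‖ = d
  le : ∀ j (x : (Ω j).Boundary) (y : (Ω (1 - j)).Boundary), d ≤ ‖(x : Plane) - y‖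

theorem Config.exists_closest (hc : Config Ω α n c) : ∃ p d, Closest Ω p d := by
  have hcont : Continuous fun z : (Ω 0).Boundary × (Ω 1).Boundary => ‖(z.1 : Plane) - z.2‖ := by
    fun_prop
  obtain ⟨z, -, hz⟩ := isCompact_univ.exists_isMinOn univ_nonempty hcont.continuousOn
  have hz' : ∀ x y, ‖(z.1 : Plane) - z.2‖ ≤ ‖((x : (Ω 0).Boundary) : Plane) - (y : (Ω 1).Boundary)‖ :=
    fun x y => isMinOn_iff.mp hz (x, y) (mem_univ _)
  have e1 : (1 : Fin 2) - 0 = 1 := rfl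
  have e2 : (1 : Fin 2) - 1 = 0 := rfl
  let p : ∀ j, (Ω j).Boundary := Fin.cons z.1 (Fin.cons z.2 finZeroElim)
  have hp0 : p 0 = z.1 := rfl
  have hp1 : p 1 = z.2 := rfl
  refine ⟨p, ‖(z.1 : Plane) - z.2‖, ?_, ?_, ?_⟩
  · refine norm_pos_iff.mpr (sub_ne_zero.mpr ?_)
    exact (hc.sep 0).ne _ ((Ω 0).mem_body _) _ ((Ω 1).mem_body _)
  · rw [Fin.forall_fin_two, e1, e2, hp0, hp1]
    exact ⟨rfl, norm_sub_rev _ _⟩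
  · rw [Fin.forall_fin_two, e1, e2]
    exact ⟨hz', fun x y => (hz' y x).trans_eq (norm_sub_rev _ _)⟩

end Growth

section Growth

variable {Ω : Fin 2 → Obstacle} {α : Plane} {n : Fin 2 → Plane} {c : ℝ}
  {p : ∀ j, (Ω j).Boundary} {d : ℝ}

theorem continuous_dirn {X : Type*} [TopologicalSpace X] {f g : X → Plane} (hf : Continuous f)
    (hg : Continuous g) (h : ∀ x, f x ≠ g x) : Continuous fun x => dirn (f x) (g x) :=
  ((hf.sub hg).norm.inv₀ fun x => norm_ne_zero_iff.mpr (sub_ne_zero.mpr (h x))).smul (hf.sub hg)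

theorem exists_kurv_ge (Ω : Fin 2 → Obstacle) :
    ∃ K, 0 < K ∧ ∀ j (y : (Ω j).Boundary), K ≤ (Ω j).kurv y := by
  have hcont : Continuous fun z : TotalBoundary Ω => (Ω z.1).kurv z.2 :=
    continuous_sigma fun j => (Ω j).continuous_kurv
  have : Nonempty (TotalBoundary Ω) := ⟨⟨0, (Ω 0).pt 0⟩⟩
  obtain ⟨z, -, hz⟩ := isCompact_univ.exists_isMinOn univ_nonempty hcont.continuousOn
  exact ⟨_, (Ω z.1).kurv_pos z.2, fun j y => isMinOn_iff.mp hz ⟨j, y⟩ (mem_univ _)⟩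

/-- Near the closest pair of points, one transmission is close to the linear model. -/
theorem Config.exists_model_error (hc : Config Ω α n c) (hC : Closest Ω p d) (j : Fin 2) {ε : ℝ}
    (hε : 0 < ε) : ∃ C, 0 ≤ C ∧ ∀ (x : (Ω j).Boundary) (y : (Ω (1 - j)).Boundary),
      c ≤ 2 * inner ℝ (dirn x y) ((Ω (1 - j)).normal y) →
        |Real.log (bend (Ω (1 - j)) x y / (2 * (Ω (1 - j)).kurv (p (1 - j))))| +
          Real.log (‖(x : Plane) - y‖ / d) ≤ ε + C * (‖(x : Plane) - y‖ - d) := by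
  have hS := hc.sep j
  have hne : ∀ z : (Ω j).Boundary × (Ω (1 - j)).Boundary, (z.1 : Plane) ≠ z.2 := fun z =>
    hS.ne _ ((Ω j).mem_body _) _ ((Ω (1 - j)).mem_body _)
  have hn : Continuous fun z : (Ω j).Boundary × (Ω (1 - j)).Boundary => (Ω (1 - j)).normal z.2 :=
    (Ω (1 - j)).continuous_normal.comp continuous_snd
  have hk : Continuous fun z : (Ω j).Boundary × (Ω (1 - j)).Boundary => (Ω (1 - j)).kurv z.2 :=
    (Ω (1 - j)).continuous_kurv.comp continuous_snd
  have hd : Continuous fun z : (Ω j).Boundary × (Ω (1 - j)).Boundary => dirn z.1 z.2 :=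
    continuous_dirn (by fun_prop) (by fun_prop) hne
  have hi := hd.inner (𝕜 := ℝ) hn
  have hρ : Continuous fun z : (Ω j).Boundary × (Ω (1 - j)).Boundary => ‖(z.1 : Plane) - z.2‖ := by
    fun_prop
  have hρ0 : ∀ z : (Ω j).Boundary × (Ω (1 - j)).Boundary, 0 < ‖(z.1 : Plane) - z.2‖ :=
    fun z => norm_pos_iff.mpr (sub_ne_zero.mpr (hne z))
  have hcpos := hS.pos
  have hkp := (Ω (1 - j)).kurv_pos (p (1 - j))
  have hpos : ∀ z ∈ {z : (Ω j).Boundary × (Ω (1 - j)).Boundary |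
      c ≤ 2 * inner ℝ (dirn z.1 z.2) ((Ω (1 - j)).normal z.2)},
      0 < inner ℝ (dirn z.1 z.2) ((Ω (1 - j)).normal z.2) := fun z hz => by
    have : c ≤ 2 * inner ℝ (dirn z.1 z.2) ((Ω (1 - j)).normal z.2) := hz
    linarith
  have hdpos := hC.pos
  suffices key : ∃ C, 0 ≤ C ∧ ∀ z ∈ {z : (Ω j).Boundary × (Ω (1 - j)).Boundary |
      c ≤ 2 * inner ℝ (dirn z.1 z.2) ((Ω (1 - j)).normal z.2)},
      |Real.log (bend (Ω (1 - j)) z.1 z.2 / (2 * (Ω (1 - j)).kurv (p (1 - j))))| +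
        Real.log (‖(z.1 : Plane) - z.2‖ / d) ≤ ε + C * (‖(z.1 : Plane) - z.2‖ - d) by
    obtain ⟨C, hC0, hCle⟩ := key
    exact ⟨C, hC0, fun x y h => hCle (x, y) h⟩
  refine exists_le_add_mul
    (K := {z : (Ω j).Boundary × (Ω (1 - j)).Boundary |
      c ≤ 2 * inner ℝ (dirn z.1 z.2) ((Ω (1 - j)).normal z.2)})
    (f := fun z => |Real.log (bend (Ω (1 - j)) z.1 z.2 / (2 * (Ω (1 - j)).kurv (p (1 - j))))| +
      Real.log (‖(z.1 : Plane) - z.2‖ / d)) (g := fun z => ‖(z.1 : Plane) - z.2‖ - d)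
    (isClosed_le continuous_const (continuous_const.mul hi)) ?_ ?_ ?_ ?_ hε
  · refine ContinuousOn.add (ContinuousOn.abs (ContinuousOn.log ?_ fun z hz => ?_))
      (ContinuousOn.log ?_ fun z hz => ?_)
    · refine ContinuousOn.div_const ?_ _
      exact ContinuousOn.div (continuous_const.mul hk).continuousOn hi.continuousOn
        fun z hz => (hpos z hz).ne'
    · have h1 := hpos z hz
      have h2 := (Ω (1 - j)).kurv_pos z.2
      unfold bend
      positivity
    · exact (hρ.div_const d).continuousOn
    · exact (div_pos (hρ0 z) hdpos).ne'
  · exact (hρ.sub continuous_const).continuousOn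
  · exact fun z _ => sub_nonneg.mpr (hC.le j z.1 z.2)
  -- At minimal distance the error vanishes: the reflection point is `p (1 - j)`, by uniqueness of
  -- the closest pair, and the ray leaves along the normal.
  · intro z _ hz
    have h1 : ‖(z.1 : Plane) - z.2‖ = d := sub_eq_zero.mp hz
    have h2 : z.2 = p (1 - j) := by
      refine closest_unique (fun x hx => hS.notMem hx) (x := z.1) (p := p j) (fun x y => ?_) ?_
      · rw [hC.eq j]; exact hC.le j x y
      · rw [hC.eq j, h1]
    have h3 : dirn z.1 z.2 = (Ω (1 - j)).normal z.2 :=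
      dirn_eq_normal_of_min (hS.notMem ((Ω j).mem_body _)) fun w => by
        rw [h1]; exact hC.le j z.1 w
    rw [bend, h3, real_inner_self_eq_norm_sq, (Ω (1 - j)).norm_normal, h2, ← h2, h1,
      div_self hdpos.ne', one_pow, div_one, h2, div_self (by positivity)]
    simp

/-- Every transmission adds at least `d`. The transmitted phase is a minimum, so the path that
bounces between the closest points bounds it from above. Hence the excess of the distances over `d`
has a bounded sum along every ray. -/
theorem Config.exists_ph_bound (hc : Config Ω α n c) (hC : Closest Ω p d) :
    ∃ M, ∀ (ℓ : ℕ) (j : Fin 2) (x : (Ω j).Boundary), |ph Ω α ℓ j x - ℓ * d| ≤ M := by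
  have h1 : Continuous fun z : TotalBoundary Ω => inner ℝ α (z.2 : Plane) :=
    continuous_sigma fun j => continuous_const.inner continuous_subtype_val
  have h2 : Continuous fun z : TotalBoundary Ω => ‖(z.2 : Plane) - p (1 - z.1)‖ :=
    continuous_sigma fun j => by
      change Continuous fun x : (Ω j).Boundary => ‖(x : Plane) - p (1 - j)‖
      fun_prop
  obtain ⟨m, hm⟩ := isCompact_univ.exists_bound_of_continuousOn h1.continuousOn
  obtain ⟨R, hR⟩ := isCompact_univ.exists_bound_of_continuousOn h2.continuousOn
  have hm' : ∀ j (x : (Ω j).Boundary), |inner ℝ α (x : Plane)| ≤ m := fun j x => by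
    have := hm ⟨j, x⟩ (mem_univ _)
    rwa [Real.norm_eq_abs] at this
  have hR' : ∀ j (x : (Ω j).Boundary), ‖(x : Plane) - p (1 - j)‖ ≤ R := fun j x => by
    have := hR ⟨j, x⟩ (mem_univ _)
    rwa [norm_norm] at this
  have hR0 : 0 ≤ R := (norm_nonneg _).trans (hR' 0 (p 0))
  have hlow : ∀ (ℓ : ℕ) (j : Fin 2) (x : (Ω j).Boundary), -m + ℓ * d ≤ ph Ω α ℓ j x := by
    intro ℓ
    induction ℓ with
    | zero => intro j x; simpa [ph] using neg_le_of_abs_le (hm' j x)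
    | succ ℓ ih =>
      intro j x
      have h3 := ih (1 - j) (tgt Ω α ℓ j x)
      have h4 := hC.le j x (tgt Ω α ℓ j x)
      change _ ≤ ph Ω α ℓ (1 - j) (tgt Ω α ℓ j x) + ‖(x : Plane) - tgt Ω α ℓ j x‖
      push_cast
      linarith
  have hp : ∀ (ℓ : ℕ) j, ph Ω α ℓ j (p j) ≤ m + ℓ * d := by
    intro ℓ
    induction ℓ with
    | zero => intro j; simpa [ph] using le_of_abs_le (hm' j (p j))
    | succ ℓ ih =>
      intro j
      have h3 := (hc.ray ℓ (1 - j)).transPhase_le (hc.sep j) (p j) (p (1 - j))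
      rw [hC.eq j] at h3
      change transPhase (Ω (1 - j)) (Ω j) (ph Ω α ℓ (1 - j)) (p j) ≤ _
      push_cast
      linarith [ih (1 - j)]
  refine ⟨m + R, fun ℓ j x => abs_le.mpr ⟨by linarith [hlow ℓ j x], ?_⟩⟩
  cases ℓ with
  | zero => have := le_of_abs_le (hm' j x); simp only [ph, Nat.cast_zero]; linarith
  | succ ℓ =>
    have h3 := (hc.ray ℓ (1 - j)).transPhase_le (hc.sep j) x (p (1 - j))
    change transPhase (Ω (1 - j)) (Ω j) (ph Ω α ℓ (1 - j)) x - _ ≤ _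
    push_cast
    linarith [hp ℓ (1 - j), hR' j x, hC.pos]

theorem Config.crv_nonneg (hc : Config Ω α n c) (ℓ : ℕ) (j : Fin 2) (x : (Ω j).Boundary) :
    0 ≤ crv Ω α ℓ j x := (hc.ray ℓ j).κ_nonneg x

/-- The mirror equation is fractional linear in the curvature, so the pair `(wid, wid * crv)`
evolves linearly, by a matrix with nonnegative entries. -/
theorem wid_succ (ℓ : ℕ) (j : Fin 2) (x : (Ω j).Boundary) :
    wid Ω α (ℓ + 1) j x =
      (1 + ‖(x : Plane) - tgt Ω α ℓ j x‖ * bend (Ω (1 - j)) x (tgt Ω α ℓ j x)) *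
        wid Ω α ℓ (1 - j) (tgt Ω α ℓ j x) + ‖(x : Plane) - tgt Ω α ℓ j x‖ *
        (wid Ω α ℓ (1 - j) (tgt Ω α ℓ j x) * crv Ω α ℓ (1 - j) (tgt Ω α ℓ j x)) := by
  rw [wid, stretch]
  change wid Ω α ℓ (1 - j) (tgt Ω α ℓ j x) * (1 + ‖(x : Plane) - tgt Ω α ℓ j x‖ *
    (crv Ω α ℓ (1 - j) (tgt Ω α ℓ j x) + bend (Ω (1 - j)) x (tgt Ω α ℓ j x))) = _
  ring

theorem Config.wid_mul_crv_succ (hc : Config Ω α n c) (ℓ : ℕ) (j : Fin 2) (x : (Ω j).Boundary) :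
    wid Ω α (ℓ + 1) j x * crv Ω α (ℓ + 1) j x =
      bend (Ω (1 - j)) x (tgt Ω α ℓ j x) * wid Ω α ℓ (1 - j) (tgt Ω α ℓ j x) +
        wid Ω α ℓ (1 - j) (tgt Ω α ℓ j x) * crv Ω α ℓ (1 - j) (tgt Ω α ℓ j x) := by
  have h1 := (hc.ray ℓ (1 - j)).stretch_pos (hc.sep j) ((Ω j).mem_body x)
  have h2 : crv Ω α (ℓ + 1) j x = (crv Ω α ℓ (1 - j) (tgt Ω α ℓ j x) +
      bend (Ω (1 - j)) x (tgt Ω α ℓ j x)) /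
        stretch (Ω (1 - j)) (ph Ω α ℓ (1 - j)) (crv Ω α ℓ (1 - j)) x := rfl
  rw [h2, wid]
  field_simp
  ring

theorem Config.two_mul_le_bend (hc : Config Ω α n c) {K : ℝ}
    (hK : ∀ j (y : (Ω j).Boundary), K ≤ (Ω j).kurv y) (ℓ : ℕ) (j : Fin 2) (x : (Ω j).Boundary) :
    2 * K ≤ bend (Ω (1 - j)) x (tgt Ω α ℓ j x) := by
  have h1 := (hc.ray ℓ (1 - j)).cos_pos (hc.sep j) ((Ω j).mem_body x)
  have h2 := (hc.ray ℓ (1 - j)).lit_le_one (tgt Ω α ℓ j x)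
  have h3 := hK (1 - j) (tgt Ω α ℓ j x)
  have h4 := (Ω (1 - j)).kurv_pos (tgt Ω α ℓ j x)
  unfold tgt at h2
  rw [(hc.ray ℓ (1 - j)).lit_target (hc.sep j) ((Ω j).mem_body x)] at h2
  change inner ℝ (dirn x (tgt Ω α ℓ j x)) ((Ω (1 - j)).normal (tgt Ω α ℓ j x)) ≤ 1 at h2
  change 0 < inner ℝ (dirn x (tgt Ω α ℓ j x)) ((Ω (1 - j)).normal (tgt Ω α ℓ j x)) at h1
  rw [bend, le_div_iff₀ h1]
  nlinarith

/-- The wave fronts widen at each step by a factor that is bounded below. -/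
theorem Config.pow_le_wid (hc : Config Ω α n c) (hC : Closest Ω p d) {K : ℝ} (hK0 : 0 < K)
    (hK : ∀ j (y : (Ω j).Boundary), K ≤ (Ω j).kurv y) (ℓ : ℕ) (j : Fin 2) (x : (Ω j).Boundary) :
    (1 + d * (2 * K)) ^ ℓ ≤ wid Ω α ℓ j x := by
  induction ℓ generalizing j with
  | zero => exact (pow_zero _).le
  | succ ℓ ih =>
    have h1 := hc.two_mul_le_bend hK ℓ j x
    have h2 := hC.le j x (tgt Ω α ℓ j x)
    have h3 := hc.crv_nonneg ℓ (1 - j) (tgt Ω α ℓ j x)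
    have h4 := hC.pos
    rw [pow_succ, wid]
    refine mul_le_mul (ih _ _) ?_ (by positivity) (hc.wid_pos ℓ _ _).le
    change _ ≤ 1 + ‖(x : Plane) - tgt Ω α ℓ j x‖ * (crv Ω α ℓ (1 - j) (tgt Ω α ℓ j x) +
      bend (Ω (1 - j)) x (tgt Ω α ℓ j x))
    have h5 : d * (2 * K) ≤ ‖(x : Plane) - tgt Ω α ℓ j x‖ * (crv Ω α ℓ (1 - j) (tgt Ω α ℓ j x) +
      bend (Ω (1 - j)) x (tgt Ω α ℓ j x)) :=
      mul_le_mul h2 (by linarith) (by positivity) (by linarith)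
    linarith

/-- Turns the logarithmic error into comparisons of the matrix entries with those of the model. Only
`b'` needs a two-sided control, since `ρ ≥ d`. -/
theorem model_bounds {ρ d b b' τ : ℝ} (hd : 0 < d) (hρ : d ≤ ρ) (hb : 0 < b) (hb' : 0 < b')
    (h : |Real.log (b' / b)| + Real.log (ρ / d) ≤ τ) :
    0 ≤ τ ∧ ρ ≤ Real.exp τ * d ∧ b' ≤ Real.exp τ * b ∧ ρ * b' ≤ Real.exp τ * (d * b) ∧
      Real.exp (-τ) * b ≤ b' := by
  have hρ0 : 0 < ρ := hd.trans_le hρ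
  have h1 : 0 ≤ Real.log (ρ / d) := Real.log_nonneg (by rwa [le_div_iff₀ hd, one_mul])
  have h2 := abs_le.mp (le_refl |Real.log (b' / b)|)
  have h3 : ρ / d = Real.exp (Real.log (ρ / d)) := (Real.exp_log (by positivity)).symm
  have h4 : b' / b = Real.exp (Real.log (b' / b)) := (Real.exp_log (by positivity)).symm
  refine ⟨by linarith [h2.1, h2.2, abs_nonneg (Real.log (b' / b))], ?_, ?_, ?_, ?_⟩
  · rw [← div_le_iff₀ hd, h3]
    exact Real.exp_le_exp.mpr (by linarith [abs_nonneg (Real.log (b' / b))])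
  · rw [← div_le_iff₀ hb, h4]
    exact Real.exp_le_exp.mpr (by linarith [h2.1, h2.2])
  · rw [← div_le_iff₀ (by positivity), mul_div_mul_comm, h3, h4, ← Real.exp_add]
    exact Real.exp_le_exp.mpr (by linarith [h2.1, h2.2])
  · rw [← le_div_iff₀ hb, h4]
    exact Real.exp_le_exp.mpr (by linarith [h2.1, h2.2])

/-- The exponential growth rate of the widths of the wave fronts exists, uniformly in all rays. -/
theorem Config.exists_growth_rate (hc : Config Ω α n c) :
    ∃ μ : ℝ, ∀ ε > 0, ∃ C, ∀ (ℓ : ℕ) (j : Fin 2) (x : (Ω j).Boundary),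
      |Real.log (wid Ω α (ℓ + 1) j x) - (ℓ + 1 : ℕ) * μ| ≤ ε * (ℓ + 1 : ℕ) + C := by
  obtain ⟨p, d, hC⟩ := hc.exists_closest
  obtain ⟨K, hK0, hK⟩ := exists_kurv_ge Ω
  obtain ⟨M, hM⟩ := hc.exists_ph_bound hC
  have hd := hC.pos
  have hb : ∀ j, 0 < 2 * (Ω j).kurv (p j) := fun j => by
    have := (Ω j).kurv_pos (p j); positivity
  obtain ⟨μ, a, g, hμ, ha, hg, hag, hag'⟩ := exists_model hd hb
  refine ⟨Real.log μ, fun ε hε => ?_⟩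
  obtain ⟨C, hC0, hmod⟩ : ∃ C, 0 ≤ C ∧
      ∀ (ℓ : ℕ) (j : Fin 2) (x : (Ω j).Boundary),
      |Real.log (bend (Ω (1 - j)) x (tgt Ω α ℓ j x) / (2 * (Ω (1 - j)).kurv (p (1 - j))))| +
        Real.log (‖(x : Plane) - tgt Ω α ℓ j x‖ / d) ≤
          ε + C * (‖(x : Plane) - tgt Ω α ℓ j x‖ - d) := by
    choose C hC0 hCle using fun j => hc.exists_model_error hC j hε
    refine ⟨C 0 + C 1, add_nonneg (hC0 0) (hC0 1), fun ℓ j x => ?_⟩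
    refine (hCle j x (tgt Ω α ℓ j x)
      (((hc.ray ℓ (1 - j)).isTarget_iff (hc.sep j) ((Ω j).mem_body x) _).mp
        ((hc.ray ℓ (1 - j)).isTarget_target x)).2.2).trans ?_
    have h1 : C j ≤ C 0 + C 1 := by
      revert j
      rw [Fin.forall_fin_two]
      exact ⟨fun _ => by linarith [hC0 1], fun _ => by linarith [hC0 0]⟩
    have h2 := mul_le_mul_of_nonneg_right h1 (sub_nonneg.mpr (hC.le j x (tgt Ω α ℓ j x)))
    linarith
  have hbnd : ∀ (ℓ : ℕ) (j : Fin 2) (x : (Ω j).Boundary), _ := fun ℓ j x => model_bounds hd (hC.le j x (tgt Ω α ℓ j x))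
    (hb (1 - j)) ((mul_pos two_pos hK0).trans_le (hc.two_mul_le_bend hK ℓ j x)) (hmod ℓ j x)
  -- The phase adds up the distances, so `C * (ph - ℓ * d)` in the exponents below absorbs the
  -- errors `C * (ρ - d)` of the single steps; it is bounded by `C * M`.
  have hph : ∀ (ℓ : ℕ) (j : Fin 2) (x : (Ω j).Boundary), ph Ω α (ℓ + 1) j x =
      ph Ω α ℓ (1 - j) (tgt Ω α ℓ j x) + ‖(x : Plane) - tgt Ω α ℓ j x‖ := fun _ _ _ => rfl
  have hμexp : Real.exp (Real.log μ) = μ := Real.exp_log hμ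
  -- the upper bound
  obtain ⟨B, hB⟩ : ∃ B, ∀ (ℓ : ℕ) (j : Fin 2) (x : (Ω j).Boundary),
      wid Ω α ℓ j x ≤ Real.exp (B + ℓ * Real.log μ + ε * ℓ + C * (ph Ω α ℓ j x - ℓ * d)) * a j ∧
      wid Ω α ℓ j x * crv Ω α ℓ j x ≤
        Real.exp (B + ℓ * Real.log μ + ε * ℓ + C * (ph Ω α ℓ j x - ℓ * d)) * g j := by
    -- Chosen so that the bound holds for the initial width `1`; `C * M` compensates the initial
    -- phase.
    refine ⟨C * M - Real.log (min (a 0) (a 1)), fun ℓ => ?_⟩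
    induction ℓ with
    | zero =>
      intro j x
      have hmin : 0 < min (a 0) (a 1) := lt_min (ha 0) (ha 1)
      have h1 : -M ≤ ph Ω α 0 j x - (0 : ℕ) * d := neg_le_of_abs_le (hM 0 j x)
      constructor
      · have h2 : min (a 0) (a 1) ≤ a j := by
          revert j
          rw [Fin.forall_fin_two]
          exact ⟨fun _ _ => min_le_left _ _, fun _ _ => min_le_right _ _⟩
        have h3 : Real.exp (-Real.log (min (a 0) (a 1))) ≤ Real.exp (C * M -
            Real.log (min (a 0) (a 1)) + (0 : ℕ) * Real.log μ + ε * (0 : ℕ) +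
              C * (ph Ω α 0 j x - (0 : ℕ) * d)) := by
          refine Real.exp_le_exp.mpr ?_
          have := mul_le_mul_of_nonneg_left h1 hC0
          simp only [Nat.cast_zero] at this ⊢
          linarith
        rw [Real.exp_neg, Real.exp_log hmin] at h3
        calc wid Ω α 0 j x = (min (a 0) (a 1))⁻¹ * min (a 0) (a 1) :=
              (inv_mul_cancel₀ hmin.ne').symm
          _ ≤ _ := mul_le_mul h3 h2 hmin.le (Real.exp_pos _).le
      · have : wid Ω α 0 j x * crv Ω α 0 j x = 0 := mul_zero _
        rw [this]
        exact mul_nonneg (Real.exp_pos _).le (hg j).le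
    | succ ℓ ih =>
      intro j x
      obtain ⟨h1, h2⟩ := ih (1 - j) (tgt Ω α ℓ j x)
      obtain ⟨h3, h4, h5, h6, -⟩ := hbnd ℓ j x
      have hw := (hc.wid_pos ℓ (1 - j) (tgt Ω α ℓ j x)).le
      have hv := mul_nonneg hw (hc.crv_nonneg ℓ (1 - j) (tgt Ω α ℓ j x))
      have hX : ∀ B : ℝ, Real.exp (B + (ℓ + 1 : ℕ) * Real.log μ + ε * (ℓ + 1 : ℕ) +
          C * (ph Ω α (ℓ + 1) j x - (ℓ + 1 : ℕ) * d)) =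
          Real.exp (ε + C * (‖(x : Plane) - tgt Ω α ℓ j x‖ - d)) *
            Real.exp (B + ℓ * Real.log μ + ε * ℓ +
              C * (ph Ω α ℓ (1 - j) (tgt Ω α ℓ j x) - ℓ * d)) * μ := fun B => by
        rw [← Real.exp_add]
        nth_rw 3 [← hμexp]
        rw [← Real.exp_add, hph]
        congr 1
        push_cast
        ring
      have hE1 := Real.one_le_exp h3
      rw [hX, hc.wid_mul_crv_succ, wid_succ]
      generalize Real.exp (ε + C * (‖(x : Plane) - tgt Ω α ℓ j x‖ - d)) = E at *
      generalize Real.exp (_ + C * (ph Ω α ℓ (1 - j) (tgt Ω α ℓ j x) - ℓ * d)) = X at *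
      have hE : 0 ≤ E := by linarith
      have hdn := norm_nonneg ((x : Plane) - tgt Ω α ℓ j x)
      have hbe := (hb (1 - j)).le
      constructor
      · rw [mul_assoc _ μ, ← hag j]
        have e1 := mul_le_mul (show 1 + ‖(x : Plane) - tgt Ω α ℓ j x‖ *
          bend (Ω (1 - j)) x (tgt Ω α ℓ j x) ≤ E * (1 + d * (2 * (Ω (1 - j)).kurv (p (1 - j))))
          by linarith) h1 hw (by positivity)
        have e2 := mul_le_mul h4 h2 hv (by positivity)
        linarith
      · rw [mul_assoc _ μ, ← hag' j]
        have e1 := mul_le_mul h5 h1 hw (by positivity)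
        have e2 := mul_le_mul hE1 h2 hv (by positivity)
        linarith
  -- the lower bound
  obtain ⟨B', hB'⟩ : ∃ B, ∀ (ℓ : ℕ) (j : Fin 2) (x : (Ω j).Boundary),
      Real.exp (B + (ℓ + 1 : ℕ) * Real.log μ - ε * (ℓ + 1 : ℕ) -
        C * (ph Ω α (ℓ + 1) j x - (ℓ + 1 : ℕ) * d)) * a j ≤ wid Ω α (ℓ + 1) j x ∧
      Real.exp (B + (ℓ + 1 : ℕ) * Real.log μ - ε * (ℓ + 1 : ℕ) -
        C * (ph Ω α (ℓ + 1) j x - (ℓ + 1 : ℕ) * d)) * g j ≤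
          wid Ω α (ℓ + 1) j x * crv Ω α (ℓ + 1) j x := by
    set Q := a 0 + a 1 + (g 0 + g 1) with hQ
    have hQ0 : 0 < Q := by have := ha 0; have := ha 1; have := hg 0; have := hg 1; positivity
    -- The lower bound starts after one step: the plane wave has curvature `0`, below any positive
    -- multiple of `g`. One reflection makes the width at least `1` and `wid * crv` at least `2 *
    -- K`. The term `-log μ` in the next constant offsets this first step, and `Q` dominates all
    -- entries of the eigenvector.
    have hq0 : 0 < min 1 (2 * K) := lt_min one_pos (by positivity)
    refine ⟨Real.log (min 1 (2 * K)) - Real.log Q - Real.log μ - C * M, fun ℓ => ?_⟩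
    induction ℓ with
    | zero =>
      intro j x
      have h1 : -M ≤ ph Ω α (0 + 1) j x - (0 + 1 : ℕ) * d := neg_le_of_abs_le (hM (0 + 1) j x)
      have h3 : Real.exp (Real.log (min 1 (2 * K)) - Real.log Q - Real.log μ - C * M +
          (0 + 1 : ℕ) * Real.log μ - ε * (0 + 1 : ℕ) -
            C * (ph Ω α (0 + 1) j x - (0 + 1 : ℕ) * d)) ≤ min 1 (2 * K) / Q := by
        rw [← Real.exp_log (div_pos hq0 hQ0), Real.log_div hq0.ne' hQ0.ne']
        refine Real.exp_le_exp.mpr ?_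
        have := mul_le_mul_of_nonneg_left h1 hC0
        push_cast at this ⊢
        linarith
      have h4 : ∀ t, 0 ≤ t → t ≤ Q → Real.exp (Real.log (min 1 (2 * K)) - Real.log Q -
          Real.log μ - C * M + (0 + 1 : ℕ) * Real.log μ - ε * (0 + 1 : ℕ) -
            C * (ph Ω α (0 + 1) j x - (0 + 1 : ℕ) * d)) * t ≤ min 1 (2 * K) := fun t ht htQ =>
        (mul_le_mul h3 htQ ht (by positivity)).trans_eq (div_mul_cancel₀ _ hQ0.ne')
      have h5 : a j ≤ Q ∧ g j ≤ Q := by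
        have := ha 0; have := ha 1; have := hg 0; have := hg 1
        revert j
        rw [Fin.forall_fin_two]
        exact ⟨fun _ _ _ _ => ⟨by linarith, by linarith⟩,
          fun _ _ _ _ => ⟨by linarith, by linarith⟩⟩
      have h6 := hc.two_mul_le_bend hK 0 j x
      have h7 : ∀ i y, wid Ω α 0 i y = 1 := fun _ _ => rfl
      have h8 : ∀ i y, crv Ω α 0 i y = 0 := fun _ _ => rfl
      rw [hc.wid_mul_crv_succ, wid_succ, h7, h8]
      constructor
      · refine (h4 _ (ha j).le h5.1).trans ((min_le_left _ _).trans ?_)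
        have := mul_nonneg (norm_nonneg ((x : Plane) - tgt Ω α 0 j x))
          ((mul_pos two_pos hK0).le.trans h6)
        linarith
      · refine (h4 _ (hg j).le h5.2).trans ((min_le_right _ _).trans ?_)
        linarith
    | succ ℓ ih =>
      intro j x
      obtain ⟨h1, h2⟩ := ih (1 - j) (tgt Ω α (ℓ + 1) j x)
      obtain ⟨h3, -, -, -, h5⟩ := hbnd (ℓ + 1) j x
      have h4 := hC.le j x (tgt Ω α (ℓ + 1) j x)
      have hX : ∀ B : ℝ, Real.exp (B + (ℓ + 1 + 1 : ℕ) * Real.log μ - ε * (ℓ + 1 + 1 : ℕ) -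
          C * (ph Ω α (ℓ + 1 + 1) j x - (ℓ + 1 + 1 : ℕ) * d)) =
          Real.exp (-(ε + C * (‖(x : Plane) - tgt Ω α (ℓ + 1) j x‖ - d))) *
            Real.exp (B + (ℓ + 1 : ℕ) * Real.log μ - ε * (ℓ + 1 : ℕ) -
              C * (ph Ω α (ℓ + 1) (1 - j) (tgt Ω α (ℓ + 1) j x) - (ℓ + 1 : ℕ) * d)) * μ :=
        fun B => by
        rw [← Real.exp_add]
        nth_rw 3 [← hμexp]
        rw [← Real.exp_add, hph]
        congr 1
        push_cast
        ring
      have hE1 : Real.exp (-(ε + C * (‖(x : Plane) - tgt Ω α (ℓ + 1) j x‖ - d))) ≤ 1 :=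
        Real.exp_le_one_iff.mpr (by linarith)
      have hE0 := Real.exp_pos (-(ε + C * (‖(x : Plane) - tgt Ω α (ℓ + 1) j x‖ - d)))
      rw [hX, hc.wid_mul_crv_succ (ℓ + 1), wid_succ (ℓ + 1)]
      generalize Real.exp (-(ε + C * (‖(x : Plane) - tgt Ω α (ℓ + 1) j x‖ - d))) = E at *
      have hX0 : 0 < Real.exp (Real.log (min 1 (2 * K)) - Real.log Q - Real.log μ - C * M +
        (ℓ + 1 : ℕ) * Real.log μ - ε * (ℓ + 1 : ℕ) -
          C * (ph Ω α (ℓ + 1) (1 - j) (tgt Ω α (ℓ + 1) j x) - (ℓ + 1 : ℕ) * d)) := Real.exp_pos _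
      generalize Real.exp (_ - C * (ph Ω α (ℓ + 1) (1 - j) (tgt Ω α (ℓ + 1) j x) -
        (ℓ + 1 : ℕ) * d)) = X at *
      have hbe := hb (1 - j)
      have ha' := ha (1 - j)
      have hg' := hg (1 - j)
      have hdn := norm_nonneg ((x : Plane) - tgt Ω α (ℓ + 1) j x)
      have hbend : 0 ≤ bend (Ω (1 - j)) x (tgt Ω α (ℓ + 1) j x) := le_trans (by positivity) h5
      constructor
      · rw [mul_assoc _ μ, ← hag j]
        have e0 : d * (E * (2 * (Ω (1 - j)).kurv (p (1 - j)))) ≤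
            ‖(x : Plane) - tgt Ω α (ℓ + 1) j x‖ * bend (Ω (1 - j)) x (tgt Ω α (ℓ + 1) j x) :=
          mul_le_mul h4 h5 (by positivity) hdn
        have e1 := mul_le_mul (show E * (1 + d * (2 * (Ω (1 - j)).kurv (p (1 - j)))) ≤
          1 + ‖(x : Plane) - tgt Ω α (ℓ + 1) j x‖ * bend (Ω (1 - j)) x (tgt Ω α (ℓ + 1) j x)
          by linarith) h1 (by positivity) (by positivity)
        have e3 : E * d ≤ ‖(x : Plane) - tgt Ω α (ℓ + 1) j x‖ :=
          (mul_le_of_le_one_left hd.le hE1).trans h4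
        have e2 := mul_le_mul e3 h2 (by positivity) (by positivity)
        linarith
      · rw [mul_assoc _ μ, ← hag' j]
        have e1 := mul_le_mul h5 h1 (by positivity) hbend
        have e2 := mul_le_mul hE1 h2 (by positivity) zero_le_one
        linarith
  -- conclusion
  refine ⟨|B| + |B'| + C * M + |Real.log (a 0)| + |Real.log (a 1)|, fun ℓ j x => ?_⟩
  have hw := hc.wid_pos (ℓ + 1) j x
  have h1 := Real.log_le_log hw (hB (ℓ + 1) j x).1
  have h2 := Real.log_le_log (mul_pos (Real.exp_pos _) (ha j)) (hB' ℓ j x).1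
  rw [Real.log_mul (Real.exp_pos _).ne' (ha j).ne', Real.log_exp] at h1 h2
  have h3 := mul_le_mul_of_nonneg_left (le_of_abs_le (hM (ℓ + 1) j x)) hC0
  have h4 : |Real.log (a j)| ≤ |Real.log (a 0)| + |Real.log (a 1)| := by
    have e0 := abs_nonneg (Real.log (a 0))
    have e1 := abs_nonneg (Real.log (a 1))
    clear * - e0 e1
    revert j
    rw [Fin.forall_fin_two]
    constructor <;> linarith
  have h5 := abs_le.mp h4
  have h6 := le_abs_self B
  have h7 := neg_abs_le B'
  have h8 := abs_nonneg B
  have h9 := abs_nonneg B'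
  rw [abs_le]
  constructor <;> linarith [h5.1, h5.2]

end Growth

theorem tendsto_rpow_inv_of_log {N : ℕ → ℝ} {a : ℝ} (hN : ∀ ℓ, 0 < N (ℓ + 1))
    (h : ∀ ε > 0, ∃ C, ∀ ℓ : ℕ,
      |Real.log (N (ℓ + 1)) - (ℓ + 1 : ℕ) * a| ≤ ε * (ℓ + 1 : ℕ) + C) :
    Tendsto (fun ℓ : ℕ => N ℓ ^ ((1 : ℝ) / ℓ)) atTop (𝓝 (Real.exp a)) := by
  rw [← tendsto_add_atTop_iff_nat 1]
  have h1 : (fun ℓ : ℕ => N (ℓ + 1) ^ ((1 : ℝ) / (ℓ + 1 : ℕ))) =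
      fun ℓ : ℕ => Real.exp (Real.log (N (ℓ + 1)) / (ℓ + 1 : ℕ)) := funext fun ℓ => by
    rw [Real.rpow_def_of_pos (hN ℓ), mul_one_div]
  rw [h1]
  refine (Real.continuous_exp.tendsto a).comp (Metric.tendsto_atTop.mpr fun ε hε => ?_)
  obtain ⟨C, hC⟩ := h (ε / 2) (by positivity)
  obtain ⟨m, hm⟩ := exists_nat_gt (2 * C / ε)
  refine ⟨m, fun ℓ hℓ => ?_⟩
  have hpos : (0 : ℝ) < (ℓ + 1 : ℕ) := by positivity
  have hbig : 2 * C < ε * (ℓ + 1 : ℕ) := by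
    have h2 : (m : ℝ) ≤ (ℓ + 1 : ℕ) := by exact_mod_cast hℓ.trans (Nat.le_succ ℓ)
    rw [div_lt_iff₀ hε] at hm
    nlinarith
  have h3 : Real.log (N (ℓ + 1)) / (ℓ + 1 : ℕ) - a =
      (Real.log (N (ℓ + 1)) - (ℓ + 1 : ℕ) * a) / (ℓ + 1 : ℕ) := by field_simp
  rw [Real.dist_eq, h3, abs_div, abs_of_pos hpos, div_lt_iff₀ hpos]
  linarith [hC ℓ]

theorem le_of_tendsto_rpow_inv {N : ℕ → ℝ} {r C δ : ℝ} (hC : 0 < C) (hδ : 0 < δ)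
    (hN0 : ∀ ℓ, 0 ≤ N ℓ) (hN : ∀ ℓ, N ℓ ≤ C * δ ^ ℓ)
    (h : Tendsto (fun ℓ : ℕ => N ℓ ^ ((1 : ℝ) / ℓ)) atTop (𝓝 r)) : r ≤ δ := by
  have h1 : Tendsto (fun ℓ : ℕ => C ^ ((1 : ℝ) / ℓ) * δ) atTop (𝓝 (C ^ (0 : ℝ) * δ)) :=
    ((Real.continuous_const_rpow hC.ne').tendsto 0 |>.comp
      tendsto_one_div_atTop_nhds_zero_nat).mul_const δ
  rw [Real.rpow_zero, one_mul] at h1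
  refine le_of_tendsto_of_tendsto h h1 ?_
  filter_upwards [eventually_gt_atTop 0] with ℓ hℓ
  calc N ℓ ^ ((1 : ℝ) / ℓ) ≤ (C * δ ^ ℓ) ^ ((1 : ℝ) / ℓ) :=
        Real.rpow_le_rpow (hN0 ℓ) (hN ℓ) (by positivity)
    _ = C ^ ((1 : ℝ) / ℓ) * δ := by
        rw [Real.mul_rpow hC.le (by positivity), one_div, Real.pow_rpow_inv_natCast hδ.le hℓ.ne']

/-! ### Norm bounds for the iterates and the spectral radius. -/

section Main

variable {Ω : Fin 2 → Obstacle} {α : Plane} {n : Fin 2 → Plane} {c : ℝ}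

/-- The cosine at the start of the ray is at least `c / 2` and the one at its end at most `1`, so
grazing incidence costs no more than a constant, whatever `ℓ`. -/
theorem Config.norm_amp_le (hc : Config Ω α n c) {k : ℝ} {ℓ : ℕ} {j : Fin 2} {x : (Ω j).Boundary}
    {h : TotalBoundary Ω → ℂ} {m : ℝ} (hm : ∀ z, ‖h z‖ ≤ m) :
    ‖(kirchhoffWave Ω α k (ℓ + 1) h).amp j x‖ ≤ 2 / c * m / √(wid Ω α (ℓ + 1) j x) := by
  obtain ⟨z, hz, hzh⟩ := hc.norm_amp_eq ℓ j x
  have hcp := (hc.sep j).pos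
  have h1 : 0 < lit (Ω z.1) (fun _ => α) z.2 := by linarith
  have h2 := Real.sqrt_pos.mpr (hc.wid_pos (ℓ + 1) j x)
  have h3 := (hc.ray (ℓ + 1) j).lit_le_one x
  have hm0 : 0 ≤ m := (norm_nonneg _).trans (hm z)
  rw [hzh, ← div_div]
  refine div_le_div_of_nonneg_right ?_ h2.le
  rw [div_le_iff₀ h1]
  calc lit (Ω j) (dir Ω α (ℓ + 1) j) x * ‖h z‖ ≤ 1 * m :=
        mul_le_mul h3 (hm z) (norm_nonneg _) zero_le_one
    _ ≤ (2 / c * lit (Ω z.1) (fun _ => α) z.2) * m := by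
        refine mul_le_mul_of_nonneg_right ?_ hm0
        rw [div_mul_eq_mul_div, le_div_iff₀ hcp]
        linarith
    _ = 2 / c * m * lit (Ω z.1) (fun _ => α) z.2 := by ring

/-- Away from the shadow boundary the amplitude of the transmitted constant function is not smaller
than the width of the wave front predicts. -/
theorem Config.le_norm_amp_one (hc : Config Ω α n c) (k : ℝ) (ℓ : ℕ) {j : Fin 2}
    {x : (Ω j).Boundary} (hx : c ≤ 2 * lit (Ω j) (dir Ω α (ℓ + 1) j) x) :
    c / 2 / √(wid Ω α (ℓ + 1) j x) ≤ ‖(kirchhoffWave Ω α k (ℓ + 1) fun _ => 1).amp j x‖ := by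
  obtain ⟨z, hz, hzh⟩ := hc.norm_amp_eq ℓ j x
  have hcp := (hc.sep j).pos
  have h1 : 0 < lit (Ω z.1) (fun _ => α) z.2 := by linarith
  have h2 := Real.sqrt_pos.mpr (hc.wid_pos (ℓ + 1) j x)
  have h3 : lit (Ω z.1) (fun _ => α) z.2 ≤ 1 := (hc.ray 0 z.1).lit_le_one z.2
  rw [hzh, norm_one, mul_one, ← div_div]
  refine div_le_div_of_nonneg_right ?_ h2.le
  rw [le_div_iff₀ h1]
  nlinarith

/-- The `ℓ`-th iterate as a bounded operator. -/
theorem Config.exists_operator (hc : Config Ω α n c) {C δ : ℝ} (hC : 0 ≤ C) (hδ : 0 ≤ δ)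
    (hbd : ∀ (k : ℝ) (ℓ : ℕ) (j : Fin 2) (x : (Ω j).Boundary) (h : TotalBoundary Ω → ℂ) (m : ℝ),
      (∀ z, ‖h z‖ ≤ m) → ‖(kirchhoffWave Ω α k ℓ h).amp j x‖ ≤ C * δ ^ ℓ * m) (k : ℝ) (ℓ : ℕ) :
    ∃ T : C(TotalBoundary Ω, ℂ) →L[ℂ] C(TotalBoundary Ω, ℂ),
      (∀ h x, T h x = kirchhoffPow Ω α k ℓ h x) ∧ ‖T‖ ≤ C * δ ^ ℓ := by
  let T : C(TotalBoundary Ω, ℂ) →ₗ[ℂ] C(TotalBoundary Ω, ℂ) :=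
    { toFun h := ⟨kirchhoffPow Ω α k ℓ h, hc.continuous_kirchhoffPow k ℓ h.continuous⟩
      map_add' h g := by
        ext x
        change kirchhoffPow Ω α k ℓ (⇑h + ⇑g) x = kirchhoffPow Ω α k ℓ h x + kirchhoffPow Ω α k ℓ g x
        rw [kirchhoffPow, kirchhoffPow, kirchhoffPow, Wave.toFun, Wave.toFun, Wave.toFun,
          hc.amp_add, phase_kirchhoffWave, phase_kirchhoffWave, phase_kirchhoffWave, mul_add]
      map_smul' a h := by
        ext x
        change kirchhoffPow Ω α k ℓ (a • ⇑h) x = a * kirchhoffPow Ω α k ℓ h x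
        rw [kirchhoffPow, kirchhoffPow, Wave.toFun, Wave.toFun,
          hc.amp_smul, phase_kirchhoffWave, phase_kirchhoffWave, mul_left_comm] }
  have hT : ∀ h, ‖T h‖ ≤ C * δ ^ ℓ * ‖h‖ := fun h => by
    refine (ContinuousMap.norm_le _ (by positivity)).mpr fun x => ?_
    change ‖kirchhoffPow Ω α k ℓ h x‖ ≤ _
    rw [norm_kirchhoffPow]
    exact hbd k ℓ x.1 x.2 h _ fun z => h.norm_coe_le_norm z
  exact ⟨T.mkContinuous _ hT, fun h x => rfl, T.mkContinuous_norm_le (by positivity) hT⟩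

theorem Config.exists_decay (hc : Config Ω α n c) :
    ∃ C : ℝ, 0 < C ∧ ∃ δ : ℝ, 0 < δ ∧ δ < 1 ∧
      ∀ (k : ℝ) (ℓ : ℕ) (j : Fin 2) (x : (Ω j).Boundary) (h : TotalBoundary Ω → ℂ) (m : ℝ),
        (∀ z, ‖h z‖ ≤ m) → ‖(kirchhoffWave Ω α k ℓ h).amp j x‖ ≤ C * δ ^ ℓ * m := by
  obtain ⟨p, d, hC⟩ := hc.exists_closest
  obtain ⟨K, hK0, hK⟩ := exists_kurv_ge Ω
  have hd := hC.pos
  have hcp := (hc.sep 0).pos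
  have hβ : 1 < √(1 + d * (2 * K)) := by
    rw [Real.lt_sqrt zero_le_one, one_pow]
    have : 0 < d * (2 * K) := by positivity
    linarith
  have hβ0 : 0 < √(1 + d * (2 * K)) := one_pos.trans hβ
  -- The rate comes from `pow_le_wid`. The summand `1` covers `ℓ = 0`, where no ray has been
  -- reflected.
  refine ⟨1 + 2 / c, by positivity, (√(1 + d * (2 * K)))⁻¹, by positivity,
    inv_lt_one_of_one_lt₀ hβ, fun k ℓ j x h m hm => ?_⟩
  have hm0 : 0 ≤ m := (norm_nonneg _).trans (hm ⟨j, x⟩)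
  cases ℓ with
  | zero =>
    rw [norm_amp_zero, pow_zero, mul_one]
    have : 0 ≤ 2 / c * m := by positivity
    linarith [hm ⟨j, x⟩]
  | succ ℓ =>
    refine (hc.norm_amp_le hm).trans ?_
    have h1 : √(1 + d * (2 * K)) ^ (ℓ + 1) ≤ √(wid Ω α (ℓ + 1) j x) := by
      refine Real.le_sqrt_of_sq_le ?_
      rw [pow_right_comm, Real.sq_sqrt (by positivity)]
      exact hc.pow_le_wid hC hK0 hK (ℓ + 1) j x
    calc 2 / c * m / √(wid Ω α (ℓ + 1) j x) ≤ 2 / c * m / √(1 + d * (2 * K)) ^ (ℓ + 1) := by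
          gcongr
      _ = 2 / c * (√(1 + d * (2 * K)))⁻¹ ^ (ℓ + 1) * m := by
          rw [inv_pow]; field_simp
      _ ≤ (1 + 2 / c) * (√(1 + d * (2 * K)))⁻¹ ^ (ℓ + 1) * m := by
          gcongr
          linarith

/-- Upper and lower bounds for the operator norms in terms of the widths of the wave fronts. -/
theorem Config.exists_log_norm (hc : Config Ω α n c) {k : ℝ}
    {T : ℕ → C(TotalBoundary Ω, ℂ) →L[ℂ] C(TotalBoundary Ω, ℂ)}
    (hT : ∀ ℓ h x, T ℓ h x = kirchhoffPow Ω α k ℓ h x) :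
    ∃ r : ℝ, Tendsto (fun ℓ : ℕ => ‖T ℓ‖ ^ ((1 : ℝ) / ℓ)) atTop (𝓝 r) := by
  obtain ⟨μ, hμ⟩ := hc.exists_growth_rate
  have hcp := (hc.sep 0).pos
  -- The constant function `1` is tested at a target point of the following transmission: its cosine
  -- of incidence is at least `c / 2`, so it is away from the shadow.
  have hlow : ∀ ℓ, ∃ j x, c / 2 / √(wid Ω α (ℓ + 1) j x) ≤ ‖T (ℓ + 1)‖ := fun ℓ => by
    refine ⟨1 - 0, tgt Ω α (ℓ + 1) 0 ((Ω 0).pt 0), ?_⟩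
    refine (hc.le_norm_amp_one k ℓ
      ((hc.ray (ℓ + 1) (1 - 0)).le_lit_target (hc.sep 0) ((Ω 0).mem_body _))).trans ?_
    have h1 := (T (ℓ + 1)).le_opNorm 1
    have h2 := (T (ℓ + 1) 1).norm_coe_le_norm ⟨1 - 0, tgt Ω α (ℓ + 1) 0 ((Ω 0).pt 0)⟩
    rw [hT, norm_kirchhoffPow] at h2
    have h3 : ‖(1 : C(TotalBoundary Ω, ℂ))‖ ≤ 1 :=
      (ContinuousMap.norm_le _ zero_le_one).mpr fun x => by simp
    exact h2.trans (h1.trans (mul_le_of_le_one_right (norm_nonneg _) h3))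
  have hup : ∀ ℓ (w : ℝ), 0 < w → (∀ j x, w ≤ wid Ω α (ℓ + 1) j x) →
      ‖T (ℓ + 1)‖ ≤ 2 / c / √w := fun ℓ w hw hwle => by
    refine ContinuousLinearMap.opNorm_le_bound _ (by positivity) fun h => ?_
    refine (ContinuousMap.norm_le _ (by positivity)).mpr fun x => ?_
    rw [hT, norm_kirchhoffPow]
    refine (hc.norm_amp_le fun z => h.norm_coe_le_norm z).trans ?_
    rw [div_mul_eq_mul_div (2 / c) (√w)]
    have h1 := Real.sqrt_pos.mpr hw
    have h2 := Real.sqrt_le_sqrt (hwle x.1 x.2)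
    gcongr
  have hpos : ∀ ℓ, 0 < ‖T (ℓ + 1)‖ := fun ℓ => by
    obtain ⟨j, x, h⟩ := hlow ℓ
    have := Real.sqrt_pos.mpr (hc.wid_pos (ℓ + 1) j x)
    exact lt_of_lt_of_le (by positivity) h
  -- The norms behave like `wid ^ (-1/2)`. Since `μ` is the logarithmic rate of the widths, the
  -- limit is `exp (-μ / 2)`, and an error `2 * ε` is allowed for the widths.
  refine ⟨_, tendsto_rpow_inv_of_log (a := -μ / 2) hpos fun ε hε => ?_⟩
  obtain ⟨C, hC⟩ := hμ (2 * ε) (by positivity)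
  refine ⟨|Real.log (c / 2)| + C / 2, fun ℓ => abs_le.mpr ⟨?_, ?_⟩⟩
  · obtain ⟨j, x, h⟩ := hlow ℓ
    have hw := hc.wid_pos (ℓ + 1) j x
    have h1 := Real.log_le_log (div_pos (by positivity) (Real.sqrt_pos.mpr hw)) h
    rw [Real.log_div (by positivity) (Real.sqrt_pos.mpr hw).ne', Real.log_sqrt hw.le] at h1
    have h2 := (abs_le.mp (hC ℓ j x)).2
    have h3 := neg_abs_le (Real.log (c / 2))
    linarith
  · have h1 := hup ℓ (Real.exp ((ℓ + 1 : ℕ) * μ - (2 * ε * (ℓ + 1 : ℕ) + C))) (Real.exp_pos _)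
      fun j x => by
        rw [← Real.exp_log (hc.wid_pos (ℓ + 1) j x)]
        exact Real.exp_le_exp.mpr (by linarith [(abs_le.mp (hC ℓ j x)).1])
    have h2 := Real.log_le_log (hpos ℓ) h1
    rw [Real.log_div (by positivity) (Real.sqrt_pos.mpr (Real.exp_pos _)).ne',
      Real.log_sqrt (Real.exp_pos _).le, Real.log_exp, ← inv_div c 2, Real.log_inv] at h2
    have h3 := neg_abs_le (Real.log (c / 2))
    linarith

end Main

end Kirchhoff

end

theorem mainTheorem1 (Ω : Fin 2 → Kirchhoff.Obstacle) (α : Kirchhoff.Plane) (hα : ‖α‖ = 1)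
    (hocc : Kirchhoff.NoOcclusion Ω α) :
    -- every application of the Kirchhoff operator is to phases for which it is defined
    (∀ (k : ℝ) (h : C(Kirchhoff.TotalBoundary Ω, ℂ)) (ℓ : ℕ) (j : Fin 2),
      Kirchhoff.Admissible (Ω (1 - j)) (Ω j)
        ((Kirchhoff.kirchhoffWave Ω α k ℓ h).phase (1 - j))) ∧
    ∃ C : ℝ, 0 < C ∧ ∃ δ : ℝ, 0 < δ ∧ δ < 1 ∧ ∀ k : ℝ, 0 < k →
      -- the iterates are bounded operators on the space of continuous functions
      ∃ T : ℕ → C(Kirchhoff.TotalBoundary Ω, ℂ) →L[ℂ] C(Kirchhoff.TotalBoundary Ω, ℂ),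
        (∀ ℓ h x, T ℓ h x = Kirchhoff.kirchhoffPow Ω α k ℓ h x) ∧
        (∀ h, Summable fun ℓ => ‖T ℓ h‖) ∧
        (∀ ℓ h, ‖T ℓ h‖ ≤ C * δ ^ ℓ * ‖h‖) ∧
        -- the spectral radius
        ∃ r : ℝ, Tendsto (fun ℓ : ℕ => ‖T ℓ‖ ^ ((1 : ℝ) / ℓ)) atTop (𝓝 r) ∧ r ≤ δ := by
  obtain ⟨n, c, hc⟩ := hocc.exists_config hα
  refine ⟨fun k h ℓ j => ?_, ?_⟩
  · rw [Kirchhoff.phase_kirchhoffWave]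
    exact (hc.ray ℓ (1 - j)).admissible (hc.sep j)
  obtain ⟨C, hC, δ, hδ, hδ1, hbd⟩ := hc.exists_decay
  refine ⟨C, hC, δ, hδ, hδ1, fun k _ => ?_⟩
  choose T hT hTn using hc.exists_operator hC.le hδ.le hbd k
  have hle : ∀ ℓ h, ‖T ℓ h‖ ≤ C * δ ^ ℓ * ‖h‖ := fun ℓ h =>
    (T ℓ).le_of_opNorm_le (hTn ℓ) h
  obtain ⟨r, hr⟩ := hc.exists_log_norm hT
  refine ⟨T, hT, fun h => ?_, hle, r, hr,
    Kirchhoff.le_of_tendsto_rpow_inv hC hδ (fun ℓ => norm_nonneg _) hTn hr⟩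
  exact Summable.of_nonneg_of_le (fun ℓ => norm_nonneg _) (fun ℓ => hle ℓ h)
    (((summable_geometric_of_lt_one hδ.le hδ1).mul_left C).mul_right ‖h‖)
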